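/- All graphs are finite and simple. For an integer $k\ge 0$ let $\mathcal D_k$ be the class of graphs all of whose minors have minimum degree at most $k$, and let $\widehat{\mathcal D}_k$ be the class of minimal forbidden minors of $\mathcal D_k$, that is, of the graphs that are not in $\mathcal D_k$ but all of whose proper minors are in $\mathcal D_k$. For a connected graph $G$, the blocks of $G$ are its cut-edges and its maximal 2-connected subgraphs; the block decomposition tree of $G$ has as vertices the blocks and the cut-vertices of $G$, a block $b$ being adjacent to a cut-vertex $c$ whenever $b$ contains $c$. A block decomposition tree is a tree isomorphic to the block decomposition tree of some connected graph. **Theorem.** For every block decomposition tree $T$ there is a connected graph $G$ such that 1. $T$ is (isomorphic to) the block decomposition tree of $G$; 2. $\delta(G)\ge 1$ and $G\in\widehat{\mathcal D}_{d-1}$, where $d=\delta(G)$ is the minimum degree of $G$; 3. if $T$ has at least one edge, then $\delta(G)\le 8|E(T)|$, and $G$ has (vertex-)connectivity exactly $1$. Hence minor-minimal minimum-degree graphs can have arbitrary block structure, including connectivity $1$. -/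

import Mathlib

namespace BlockStructure

universe u v

/-! ### Minors and the classes `𝒟_k`, `𝒟̂_k` -/

/-- `H` is a minor of `G`: a graph isomorphic to `H` is obtained from a subgraph of `G` by
contracting edges. The set `B w` is the branch set of the vertex `w` of `H`: branch sets are
non-empty, connected and pairwise disjoint, and every edge of `H` comes from an edge of `G`
between the two branch sets. -/
def IsMinor {W : Type v} {V : Type u} (H : SimpleGraph W) (G : SimpleGraph V) : Prop :=
  ∃ B : W → Set V,
    (∀ w, (G.induce (B w)).Connected) ∧
    (∀ w w', w ≠ w' → Disjoint (B w) (B w')) ∧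
    ∀ w w', H.Adj w w' → ∃ x ∈ B w, ∃ y ∈ B w', G.Adj x y

/-- A proper minor of `G` is a minor of `G` that is not isomorphic to `G`. -/
def IsProperMinor {W : Type v} {V : Type u} (H : SimpleGraph W) (G : SimpleGraph V) : Prop :=
  IsMinor H G ∧ IsEmpty (H ≃g G)

/-- `G ∈ 𝒟_k`: every minor of the (finite) graph `G` has minimum degree at most `k`. -/
def MemD (k : ℕ) {V : Type u} (G : SimpleGraph V) : Prop :=
  ∀ (W : Type u) [Fintype W] (H : SimpleGraph W) [DecidableRel H.Adj],
    IsMinor H G → H.minDegree ≤ k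

/-- `G ∈ 𝒟̂_k`: the (finite) graph `G` is a minimal forbidden minor of `𝒟_k`, that is, `G` is not
in `𝒟_k`, but every proper minor of `G` is in `𝒟_k`. -/
def MemDHat (k : ℕ) {V : Type u} (G : SimpleGraph V) : Prop :=
  ¬ MemD k G ∧
    ∀ (W : Type u) [Fintype W] (H : SimpleGraph W), IsProperMinor H G → MemD k H

/-! ### Blocks, cut-vertices and block decomposition trees -/

section Blocks

variable {V : Type u} (G : SimpleGraph V)

/-- `c` is a cut-vertex of `G`: deleting `c` separates two vertices of a component of `G`. -/
def IsCutVertex (c : V) : Prop :=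
  ∃ a b : ({c}ᶜ : Set V), G.Reachable a b ∧ ¬ (G.induce ({c}ᶜ : Set V)).Reachable a b

/-- The subgraph `B` of `G` is 2-connected: it has at least three vertices, it is connected, and it
stays connected when any one of its vertices is deleted. -/
def IsTwoConnected {V : Type u} {G : SimpleGraph V} (B : G.Subgraph) : Prop :=
  3 ≤ B.verts.encard ∧ B.Connected ∧ ∀ x ∈ B.verts, (B.deleteVerts {x}).Connected

/-- A block of `G` is a cut-edge of `G` (with its two ends) or a maximal 2-connected subgraph
of `G`. -/
def IsBlock (B : G.Subgraph) : Prop :=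
  (∃ (x y : V) (h : G.Adj x y), G.IsBridge s(x, y) ∧ B = G.subgraphOfAdj h) ∨
    Maximal IsTwoConnected B

/-- The block decomposition tree of a (connected) graph `G`. Its vertices are the blocks and the
cut-vertices of `G`; a block `B` is adjacent to a cut-vertex `c` whenever `B` contains `c`. -/
def blockTree : SimpleGraph ({B : G.Subgraph // IsBlock G B} ⊕ {c : V // IsCutVertex G c}) where
  Adj
    | .inl B, .inr c => c.1 ∈ B.1.verts
    | .inr c, .inl B => c.1 ∈ B.1.verts
    | _, _ => False
  symm := ⟨by rintro (B | c) (B' | c') h <;> exact h⟩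
  loopless := ⟨by rintro (B | c) h <;> exact h⟩

end Blocks

/-- `T` is the block decomposition tree of the connected graph `G` (up to isomorphism). -/
def IsBlockTreeOf {V : Type u} {W : Type v} (T : SimpleGraph V) (G : SimpleGraph W) : Prop :=
  G.Connected ∧ Nonempty (T ≃g blockTree G)

/-- A block decomposition tree is a tree that is isomorphic to the block decomposition tree of some
finite connected graph. -/
def IsBlockDecompositionTree {V : Type u} (T : SimpleGraph V) : Prop :=
  T.IsTree ∧ ∃ (W : Type) (_ : Finite W) (H : SimpleGraph W), IsBlockTreeOf T H

/-- The (vertex-)connectivity of a finite graph `G`: the least number of vertices whose deletion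
leaves a disconnected graph or a graph with at most one vertex. -/
noncomputable def vertexConnectivity {V : Type u} (G : SimpleGraph V) : ℕ :=
  sInf {k | ∃ S : Finset V, S.card = k ∧
    (¬ (G.induce ((S : Set V)ᶜ)).Preconnected ∨ ((S : Set V)ᶜ).Subsingleton)}

end BlockStructure

/-! Let `T` have n ≥ 2 vertices, and put d = 6(n - 1). Each block vertex of `T` becomes an almost
complete graph on d + 2 vertices, in which every inner vertex misses just one other vertex and so
has degree d. A cut-vertex `c` of `b` misses 6s - 5 inner vertices of `b`, where s counts the
vertices of `T` on the side of `c`. This leaves `c` with 6 neighbours in `b` for each vertex of `T`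
on the side of `b`, and over all blocks at `c` these add up to d. The graph is therefore d-regular
(`degree_eq`).

For minimality it is enough that no minor of minimum degree at least d has fewer vertices
(`memDHat_of_card_le`). Call a block full if its vertices lie in distinct branch sets. A block is so
tight that one branch set meeting it and avoiding its cut-vertices makes it full
(`isFull_of_forall_notMem`). A branch set containing a cut-vertex of a block that is not full would
have too few neighbours: at most 6 per vertex of `T` seen through full blocks, but at most 1 per
vertex of the rest (`isFull_of_mem`). Hence some block is full, fullness spreads along `T`, and
nothing is contracted or deleted.

The blocks are as intended because an edge `b c` of `T` corresponds to a separation of the graph at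
`c`. For a tree without edges, the complete graph on two vertices serves. -/

namespace BlockStructure

/-! ### Sides of an edge of a tree -/

section Tree

variable {V : Type*} {T : SimpleGraph V}

/-- The vertices that are nearer to `u` than to `v`. -/
def side (T : SimpleGraph V) (u v : V) : Set V := {x | T.dist x u < T.dist x v}

lemma mem_side {u v x : V} : x ∈ side T u v ↔ T.dist x u < T.dist x v := Iff.rfl

lemma mem_side_or (hT : T.IsTree) {u v : V} (h : T.Adj u v) (x : V) :
    x ∈ side T u v ∨ x ∈ side T v u :=
  lt_or_gt_of_ne (hT.dist_ne_of_adj x h)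

lemma notMem_side {u v x : V} (h : x ∈ side T u v) : x ∉ side T v u :=
  fun h' => lt_asymm (mem_side.1 h) (mem_side.1 h')

lemma self_mem_side {u v : V} (h : T.Adj u v) : u ∈ side T u v := by
  simp [mem_side, SimpleGraph.dist_eq_one_iff_adj.2 h]

lemma exists_mem_side (hT : T.IsTree) {x v : V} (h : x ≠ v) :
    ∃ u, T.Adj v u ∧ x ∈ side T u v := by
  obtain ⟨p, -, hp⟩ := hT.connected.exists_path_of_dist v x
  cases p with
  | nil => exact absurd rfl h
  | @cons _ u _ hadj q =>
    refine ⟨u, hadj, ?_⟩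
    have := T.dist_le q
    rw [SimpleGraph.Walk.length_cons] at hp
    rw [mem_side, T.dist_comm, T.dist_comm (u := x)]
    omega

/-- Both are the last vertex but one on the path from `x` to `v`. -/
lemma eq_of_mem_side (hT : T.IsTree) {x v u u' : V} (h : T.Adj v u) (h' : T.Adj v u')
    (hx : x ∈ side T u v) (hx' : x ∈ side T u' v) : u = u' := by
  obtain ⟨p, hp, hpd⟩ := hT.connected.exists_path_of_dist x v
  have key : ∀ w, T.Adj v w → x ∈ side T w v → w = p.penultimate := by
    intro w hw hxw
    refine hT.isAcyclic.eq_penultimate_of_adj_end hp hw ?_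
    by_contra hns
    obtain ⟨q, hq, hqd⟩ := hT.connected.exists_path_of_dist x w
    have := congrArg SimpleGraph.Walk.length
      (hT.existsUnique_path x w |>.unique hq (hp.concat hns hw))
    rw [SimpleGraph.Walk.length_concat] at this
    rw [mem_side] at hxw
    omega
  rw [key u h hx, key u' h' hx']

lemma eq_of_adj_of_mem_side (hT : T.IsTree) {u v p q : V} (h : T.Adj u v) (hpq : T.Adj p q)
    (hp : p ∈ side T u v) (hq : q ∈ side T v u) : p = u ∧ q = v := by
  have h1 := hT.dist_eq_dist_add_one_of_adj p h
  have h2 := hT.dist_eq_dist_add_one_of_adj q h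
  have h3 := hT.dist_eq_dist_add_one_of_adj u hpq
  have h4 := hT.dist_eq_dist_add_one_of_adj v hpq
  rw [mem_side] at hp hq
  rw [T.dist_comm (u := u), T.dist_comm (u := u)] at h3
  rw [T.dist_comm (u := v), T.dist_comm (u := v)] at h4
  by_cases hpu : p = u
  · subst hpu
    rw [T.dist_self] at *
    exact ⟨rfl, (hT.connected.dist_eq_zero_iff).1 (by omega)⟩
  -- The neighbour `q'` of `p` towards `u` is also the neighbour towards `v`, and so is `q`. Thus
  -- `q` would be nearer to `u` than to `v`.
  · exfalso
    obtain ⟨q', hq', hs⟩ := exists_mem_side hT (Ne.symm hpu)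
    have hs' := hs
    rw [mem_side, T.dist_comm, T.dist_comm (u := u)] at hs'
    have h5 := hT.dist_eq_dist_add_one_of_adj q' h
    have h6 := hT.dist_eq_dist_add_one_of_adj v hq'
    rw [T.dist_comm (u := v), T.dist_comm (u := v)] at h6
    have : q' = q := by
      refine eq_of_mem_side hT (x := v) hq' hpq ?_ ?_ <;>
        rw [mem_side, T.dist_comm, T.dist_comm (u := v)] <;> omega
    subst this
    omega

/-- A shortest path from `x` to `y` has to cross the edge `u v`, hence passes through `v`. -/
lemma dist_add_of_mem_side (hT : T.IsTree) {u v x y : V} (h : T.Adj u v)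
    (hx : x ∈ side T u v) (hy : y ∈ side T v u) : T.dist x y = T.dist x v + T.dist v y := by
  obtain ⟨p, -, hp⟩ := hT.connected.exists_path_of_dist x y
  obtain ⟨d, hd, h1, h2⟩ := p.exists_boundary_dart (side T u v) hx (notMem_side hy)
  have h3 : d.snd = v :=
    (eq_of_adj_of_mem_side hT h d.adj h1 ((mem_side_or hT h _).resolve_left h2)).2
  have hv : v ∈ p.support := h3 ▸ p.dart_snd_mem_support_of_mem_darts hd
  refine le_antisymm (hT.connected.dist_triangle) ?_
  classical
  have h4 := congrArg SimpleGraph.Walk.length (p.take_spec hv)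
  rw [SimpleGraph.Walk.length_append] at h4
  have := T.dist_le (p.takeUntil v hv)
  have := T.dist_le (p.dropUntil v hv)
  omega

open scoped Classical in
lemma sum_card_side [Fintype V] (hT : T.IsTree) (v : V) :
    ∑ u ∈ Finset.univ.filter (T.Adj v), (side T u v).toFinset.card = Fintype.card V - 1 := by
  rw [← Finset.card_biUnion, ← Finset.card_univ, ← Finset.card_erase_of_mem (Finset.mem_univ v)]
  · congr 1
    ext x
    simp only [Finset.mem_biUnion, Finset.mem_filter, Finset.mem_univ, true_and,
      Set.mem_toFinset, Finset.mem_erase, and_true]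
    constructor
    · rintro ⟨u, -, hu⟩ rfl
      simp [mem_side] at hu
    · exact exists_mem_side hT
  · intro u hu u' hu' hne
    rw [Function.onFun, Finset.disjoint_left]
    intro x hx hx'
    simp only [Finset.coe_filter, Finset.mem_univ, true_and, Set.mem_ofPred_eq,
      Set.mem_toFinset] at hu hu' hx hx'
    exact hne (eq_of_mem_side hT hu hu' hx hx')

open scoped Classical in
lemma card_side_add [Fintype V] (hT : T.IsTree) {u v : V} (h : T.Adj u v) :
    (side T u v).toFinset.card + (side T v u).toFinset.card = Fintype.card V := by
  rw [← Finset.card_union_of_disjoint, ← Finset.card_univ]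
  · congr 1
    ext x
    simpa using mem_side_or hT h x
  · rw [Finset.disjoint_left]
    intro x hx hx'
    simp only [Set.mem_toFinset] at hx hx'
    exact notMem_side hx hx'

end Tree

end BlockStructure

namespace BlockStructure

/-! ### Every cut-vertex lies in two blocks -/

section CutVertices

variable {V : Type*} {G : SimpleGraph V}

lemma isTwoConnected_toSubgraph {u : V} {p : G.Walk u u} (hp : p.IsCycle) :
    IsTwoConnected p.toSubgraph := by
  classical
  refine ⟨?_, p.toSubgraph_connected, ?_⟩
  · have h1 : (p.support.dropLast.toFinset : Set V) ⊆ p.toSubgraph.verts := by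
      intro x hx
      rw [SimpleGraph.Walk.mem_verts_toSubgraph]
      exact List.mem_of_mem_dropLast (by simpa using hx)
    refine le_trans ?_ (Set.encard_le_encard h1)
    rw [Set.encard_coe_eq_coe_finsetCard, List.toFinset_card_of_nodup hp.nodup_dropLast_support,
      List.length_dropLast, SimpleGraph.Walk.length_support]
    exact_mod_cast hp.three_le_length
  · intro x hx
    rw [SimpleGraph.Walk.mem_verts_toSubgraph] at hx
    -- Once the cycle starts at `x`, removing `x` leaves the path `q.dropLast`, which is connected.
    rw [← p.toSubgraph_rotate hx]
    have hc := hp.rotate hx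
    generalize p.rotate x hx = q at hc
    cases q with
    | nil => exact absurd rfl hc.ne_nil
    | @cons _ y _ h q =>
      have hq := (SimpleGraph.Walk.cons_isCycle_iff q h).1 hc
      have hnil : ¬ q.Nil := fun hn => h.ne hn.eq.symm
      have hqs := q.concat_dropLast (q.adj_penultimate hnil)
      have hsup := congrArg SimpleGraph.Walk.support hqs
      rw [SimpleGraph.Walk.support_concat] at hsup
      have hnd := hq.1.support_nodup
      rw [← hsup, List.nodup_append] at hnd
      have hx' : x ∉ q.dropLast.support := fun hxs => hnd.2.2 x hxs x (by simp) rfl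
      have hle : q.dropLast.toSubgraph ≤ q.toSubgraph := by
        have hsub := congrArg SimpleGraph.Walk.toSubgraph hqs
        rw [SimpleGraph.Walk.concat_eq_append, SimpleGraph.Walk.toSubgraph_append] at hsub
        exact le_sup_left.trans hsub.le
      have hmem : ∀ z ∈ q.dropLast.toSubgraph.verts, z ≠ x := by
        rintro z hz rfl
        exact hx' (by simpa using hz)
      have hverts : q.dropLast.toSubgraph.verts =
          ((SimpleGraph.Walk.cons h q).toSubgraph.deleteVerts {x}).verts := by
        ext z
        simp only [SimpleGraph.Walk.mem_verts_toSubgraph, SimpleGraph.Subgraph.deleteVerts_verts,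
          Set.mem_sdiff, SimpleGraph.Walk.support_cons, Set.mem_singleton_iff, ← hsup]
        grind
      refine q.dropLast.toSubgraph_connected.mono ⟨hverts.le, fun a b hab => ?_⟩ hverts
      have ha := hverts.le (q.dropLast.toSubgraph.edge_vert hab)
      have hb := hverts.le (q.dropLast.toSubgraph.edge_vert hab.symm)
      rw [SimpleGraph.Subgraph.deleteVerts_adj]
      exact ⟨ha.1, ha.2, hb.1, hb.2, Or.inr (hle.2 hab)⟩

lemma exists_isBlock_adj [Finite V] {x y : V} (h : G.Adj x y) :
    ∃ B : G.Subgraph, IsBlock G B ∧ B.Adj x y := by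
  by_cases hb : G.IsBridge s(x, y)
  · exact ⟨G.subgraphOfAdj h, Or.inl ⟨x, y, h, hb, rfl⟩, rfl⟩
  · rw [SimpleGraph.isBridge_iff_forall_cycle_notMem (G.mem_edgeSet.2 h)] at hb
    push Not at hb
    obtain ⟨u, p, hp, he⟩ := hb
    obtain ⟨B, hle, hB⟩ := (Set.toFinite {B : G.Subgraph | IsTwoConnected B}).exists_le_maximal
      (isTwoConnected_toSubgraph hp)
    exact ⟨B, Or.inr hB, hle.2 ((SimpleGraph.Walk.adj_toSubgraph_iff_mem_edges).2 he)⟩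

lemma reachable_induce_of_connected {B : G.Subgraph} (hB : B.Connected) {s : Set V}
    (h : B.verts ⊆ s) {x y : V} (hx : x ∈ B.verts) (hy : y ∈ B.verts) :
    (G.induce s).Reachable ⟨x, h hx⟩ ⟨y, h hy⟩ :=
  (hB.induce_verts.preconnected ⟨x, hx⟩ ⟨y, hy⟩).map (G.induceHomOfLE h).toHom

lemma exists_adj_reachable_compl (hG : G.Connected) {c : V} (a : ({c}ᶜ : Set V)) :
    ∃ x : ({c}ᶜ : Set V), G.Adj c x ∧ (G.induce ({c}ᶜ : Set V)).Reachable a x := by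
  obtain ⟨p⟩ := hG.preconnected a c
  obtain ⟨d, -, ⟨h1, h2⟩, h3⟩ := p.exists_boundary_dart
    {v | ∃ h : v ∈ ({c}ᶜ : Set V), (G.induce ({c}ᶜ : Set V)).Reachable a ⟨v, h⟩}
    ⟨a.2, SimpleGraph.Reachable.refl _⟩ (fun ⟨h, _⟩ => h rfl)
  have h4 : d.snd = c := by
    by_contra hne
    refine h3 ⟨hne, h2.trans (SimpleGraph.Adj.reachable ?_)⟩
    exact d.adj
  exact ⟨⟨d.fst, h1⟩, h4 ▸ d.adj.symm, h2⟩

/-- `c` has neighbours in two components of the graph without `c`. The two edges to them lie in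
different blocks, since a 2-connected block stays connected without `c` and a cut-edge has only one
other end. -/
lemma exists_two_blocks [Finite V] (hG : G.Connected) {c : V} (hc : IsCutVertex G c) :
    ∃ B₁ B₂ : G.Subgraph, IsBlock G B₁ ∧ IsBlock G B₂ ∧ B₁ ≠ B₂ ∧
      c ∈ B₁.verts ∧ c ∈ B₂.verts := by
  obtain ⟨a, b, -, hab⟩ := hc
  obtain ⟨x, hx, hax⟩ := exists_adj_reachable_compl hG a
  obtain ⟨y, hy, hby⟩ := exists_adj_reachable_compl hG b
  have hxy : ¬ (G.induce ({c}ᶜ : Set V)).Reachable x y :=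
    fun h => hab (hax.trans (h.trans hby.symm))
  obtain ⟨B₁, hB₁, h1⟩ := exists_isBlock_adj hx
  obtain ⟨B₂, hB₂, h2⟩ := exists_isBlock_adj hy
  refine ⟨B₁, B₂, hB₁, hB₂, ?_, B₁.edge_vert h1, B₂.edge_vert h2⟩
  rintro rfl
  apply hxy
  rcases hB₁ with ⟨u, v, huv, -, rfl⟩ | hB
  · have : x = y := by
      rw [SimpleGraph.subgraphOfAdj_adj] at h1 h2
      have := h1.symm.trans h2
      apply Subtype.ext
      exact Sym2.congr_right.1 this
    rw [this]
  · exact reachable_induce_of_connected (hB.prop.2.2 c (B₁.edge_vert h1)) (fun z hz => hz.2)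
      ⟨B₁.edge_vert h1.symm, x.2⟩ ⟨B₁.edge_vert h2.symm, y.2⟩

end CutVertices

end BlockStructure

namespace BlockStructure

/-! ### Minors -/

section Minors

variable {U V W : Type*}

lemma exists_adj_boundary {G : SimpleGraph V} {S : Set V} (hS : (G.induce S).Connected)
    {A : Set V} {x y : V} (hx : x ∈ S) (hxA : x ∈ A) (hy : y ∈ S) (hyA : y ∉ A) :
    ∃ u ∈ S, ∃ v ∈ S, G.Adj u v ∧ u ∈ A ∧ v ∉ A := by
  obtain ⟨p⟩ := hS.preconnected ⟨x, hx⟩ ⟨y, hy⟩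
  obtain ⟨d, -, h1, h2⟩ := p.exists_boundary_dart (Subtype.val ⁻¹' A) hxA hyA
  exact ⟨d.fst, d.fst.2, d.snd, d.snd.2, d.adj, h1, h2⟩

/-- Connectivity in terms of edges leaving a set: unions of branch sets can then be treated without
composing walks. -/
lemma connected_induce_iff_boundary {G : SimpleGraph V} {S : Set V} :
    (G.induce S).Connected ↔ S.Nonempty ∧
      ∀ A : Set V, (∃ x ∈ S, x ∈ A) → (∃ y ∈ S, y ∉ A) →
        ∃ u ∈ S, ∃ v ∈ S, G.Adj u v ∧ u ∈ A ∧ v ∉ A := by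
  constructor
  · intro h
    refine ⟨Set.nonempty_coe_sort.1 h.nonempty, ?_⟩
    rintro A ⟨x, hx, hxA⟩ ⟨y, hy, hyA⟩
    exact exists_adj_boundary h hx hxA hy hyA
  · rintro ⟨⟨x, hx⟩, h⟩
    rw [SimpleGraph.connected_iff_exists_forall_reachable]
    refine ⟨⟨x, hx⟩, ?_⟩
    by_contra! hne
    obtain ⟨⟨y, hy⟩, hxy⟩ := hne
    obtain ⟨u, hu, v, hv, huv, ⟨hu', hxu⟩, hvA⟩ :=
      h {z | ∃ hz : z ∈ S, (G.induce S).Reachable ⟨x, hx⟩ ⟨z, hz⟩}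
        ⟨x, hx, hx, SimpleGraph.Reachable.refl _⟩ ⟨y, hy, fun ⟨_, h⟩ => hxy h⟩
    exact hvA ⟨hv, hxu.trans (SimpleGraph.Adj.reachable (by exact huv))⟩

lemma IsMinor.trans {F : SimpleGraph U} {H : SimpleGraph W} {G : SimpleGraph V}
    (h : IsMinor F H) (h' : IsMinor H G) : IsMinor F G := by
  obtain ⟨A, hA, hAd, hAe⟩ := h
  obtain ⟨B, hB, hBd, hBe⟩ := h'
  refine ⟨fun u => ⋃ w ∈ A u, B w, fun u => ?_, fun u u' hne => ?_, fun u u' huu' => ?_⟩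
  · rw [connected_induce_iff_boundary]
    constructor
    · obtain ⟨w, hw⟩ := (connected_induce_iff_boundary.1 (hA u)).1
      obtain ⟨x, hx⟩ := (connected_induce_iff_boundary.1 (hB w)).1
      exact ⟨x, Set.mem_biUnion hw hx⟩
    · rintro Z ⟨x, hx, hxZ⟩ ⟨y, hy, hyZ⟩
      obtain ⟨w, hw, hxw⟩ := Set.mem_iUnion₂.1 hx
      obtain ⟨w', hw', hyw⟩ := Set.mem_iUnion₂.1 hy
      -- If `Z` splits no branch set, the crossing edge comes from an edge of `H`; otherwise it lies
      -- inside a branch set that `Z` splits.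
      by_cases hall : ∀ t ∈ A u, B t ⊆ Z ∨ Disjoint (B t) Z
      · obtain ⟨s, hs, t, ht, hst, hsZ, htZ⟩ := exists_adj_boundary (hA u) (A := {t | B t ⊆ Z}) hw
          ((hall w hw).resolve_right fun hd => Set.disjoint_left.1 hd hxw hxZ) hw'
          (fun hsub => hyZ (hsub hyw))
        obtain ⟨a, ha, b, hb, hab⟩ := hBe s t hst
        exact ⟨a, Set.mem_biUnion hs ha, b, Set.mem_biUnion ht hb, hab, hsZ ha,
          Set.disjoint_left.1 ((hall t ht).resolve_left htZ) hb⟩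
      · push Not at hall
        obtain ⟨t, ht, hn, hnd⟩ := hall
        obtain ⟨b, hb, hbZ⟩ := Set.not_subset.1 hn
        obtain ⟨a, ha, haZ⟩ := Set.not_disjoint_iff.1 hnd
        obtain ⟨p, hp, q, hq, hpq⟩ := exists_adj_boundary (hB t) ha haZ hb hbZ
        exact ⟨p, Set.mem_biUnion ht hp, q, Set.mem_biUnion ht hq, hpq⟩
  · rw [Set.disjoint_left]
    intro x hx hx'
    obtain ⟨w, hw, hxw⟩ := Set.mem_iUnion₂.1 hx
    obtain ⟨w', hw', hxw'⟩ := Set.mem_iUnion₂.1 hx'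
    by_cases hww : w = w'
    · subst hww
      exact Set.disjoint_left.1 (hAd u u' hne) hw hw'
    · exact Set.disjoint_left.1 (hBd w w' hww) hxw hxw'
  · obtain ⟨w, hw, w', hw', hadj⟩ := hAe u u' huu'
    obtain ⟨x, hx, y, hy, hxy⟩ := hBe w w' hadj
    exact ⟨x, Set.mem_biUnion hw hx, y, Set.mem_biUnion hw' hy, hxy⟩

lemma isMinor_self (G : SimpleGraph V) : IsMinor G G := by
  refine ⟨fun v => {v}, fun v => ?_, fun v w h => by simpa using h, fun v w h => ?_⟩
  · rw [connected_induce_iff_boundary]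
    refine ⟨⟨v, rfl⟩, ?_⟩
    rintro A ⟨x, rfl, hx⟩ ⟨y, rfl, hy⟩
    exact absurd hx hy
  · exact ⟨v, rfl, w, rfl, h⟩

/-- Choosing a vertex in each branch set embeds the vertices of a minor; if there is no room for
larger branch sets, this embedding preserves adjacency. -/
lemma IsMinor.exists_injective {H : SimpleGraph W} {G : SimpleGraph V} (h : IsMinor H G) :
    ∃ f : W → V, Function.Injective f ∧
      (Function.Surjective f → ∀ w w', H.Adj w w' → G.Adj (f w) (f w')) := by
  obtain ⟨B, hB, hd, he⟩ := h
  choose f hf using fun w => (connected_induce_iff_boundary.1 (hB w)).1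
  have huniq : ∀ w w', f w ∈ B w' → w = w' := fun w w' hw => by
    by_contra hne
    exact Set.disjoint_left.1 (hd w w' hne) (hf w) hw
  refine ⟨f, fun w w' hww => huniq w w' (hww ▸ hf w'), fun hs w w' hadj => ?_⟩
  obtain ⟨x, hx, y, hy, hxy⟩ := he w w' hadj
  obtain ⟨w₁, rfl⟩ := hs x
  obtain ⟨w₂, rfl⟩ := hs y
  rwa [huniq w₁ w hx, huniq w₂ w' hy] at hxy

lemma IsMinor.card_le [Fintype W] [Fintype V] {H : SimpleGraph W} {G : SimpleGraph V}
    (h : IsMinor H G) : Fintype.card W ≤ Fintype.card V := by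
  obtain ⟨f, hf, -⟩ := h.exists_injective
  exact Fintype.card_le_of_injective f hf

lemma degree_comp_le [Fintype W] [Fintype V] {H : SimpleGraph W} {G : SimpleGraph V}
    [DecidableRel H.Adj] [DecidableRel G.Adj] {f : W → V} (hf : Function.Injective f)
    (h : ∀ w w', H.Adj w w' → G.Adj (f w) (f w')) (w : W) : H.degree w ≤ G.degree (f w) := by
  rw [← SimpleGraph.card_neighborFinset_eq_degree, ← SimpleGraph.card_neighborFinset_eq_degree]
  refine Finset.card_le_card_of_injOn f (fun w' hw' => ?_) hf.injOn
  simp only [SimpleGraph.coe_neighborFinset, SimpleGraph.mem_neighborSet] at hw' ⊢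
  exact h w w' hw'

/-- With equally many vertices the branch sets are single vertices, and the degrees leave no room
for an edge of `G` that is missing in `H`. -/
lemma IsMinor.nonempty_iso [Fintype W] [Fintype V] {H : SimpleGraph W} {G : SimpleGraph V}
    [DecidableRel H.Adj] [DecidableRel G.Adj] (h : IsMinor H G)
    (hc : Fintype.card V ≤ Fintype.card W) {d : ℕ} (hH : ∀ w, d ≤ H.degree w)
    (hG : ∀ v, G.degree v ≤ d) : Nonempty (H ≃g G) := by
  obtain ⟨f, hf, he⟩ := h.exists_injective
  have hbij : Function.Bijective f :=
    (Fintype.bijective_iff_injective_and_card f).2 ⟨hf, le_antisymm h.card_le hc⟩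
  have he := he hbij.2
  refine ⟨⟨Equiv.ofBijective f hbij, fun {w w'} => ⟨fun hadj => ?_, he w w'⟩⟩⟩
  classical
  have himg : (H.neighborFinset w).image f = G.neighborFinset (f w) := by
    refine Finset.eq_of_subset_of_card_le (fun v hv => ?_) ?_
    · obtain ⟨u, hu, rfl⟩ := Finset.mem_image.1 hv
      simpa using he w u (by simpa using hu)
    · rw [Finset.card_image_of_injective _ hf, SimpleGraph.card_neighborFinset_eq_degree,
        SimpleGraph.card_neighborFinset_eq_degree]
      exact (hG _).trans (hH w)
  have : f w' ∈ G.neighborFinset (f w) := by simpa using hadj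
  rw [← himg, Finset.mem_image] at this
  obtain ⟨u, hu, huw⟩ := this
  rw [← hf huw]
  simpa using hu

end Minors

/-- A regular graph of degree `k + 1` is minimal if each of its minors of minimum degree at least
`k + 1` has as many vertices. -/
lemma memDHat_of_card_le {V : Type} [Fintype V] [Nonempty V] {G : SimpleGraph V}
    [DecidableRel G.Adj] {k : ℕ} (hG : ∀ v, G.degree v = k + 1)
    (h : ∀ (W : Type) [Fintype W] (H : SimpleGraph W) [DecidableRel H.Adj],
      Nonempty W → IsMinor H G → (∀ w, k + 1 ≤ H.degree w) → Fintype.card V ≤ Fintype.card W) :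
    G.minDegree = k + 1 ∧ MemDHat k G := by
  have hmin : G.minDegree = k + 1 := by
    obtain ⟨v, hv⟩ := G.exists_minimal_degree_vertex
    rw [hv, hG]
  refine ⟨hmin, fun hD => ?_, fun W _ H hH W' _ H' _ hH' => ?_⟩
  · have := hD V G (isMinor_self G)
    omega
  · by_contra! hlt
    have hdeg : ∀ w, k + 1 ≤ H'.degree w := fun w =>
      Nat.succ_le_of_lt (hlt.trans_le (H'.minDegree_le_degree w))
    -- A graph without vertices has minimum degree 0 by convention.
    have hne : Nonempty W' := by
      by_contra hem
      rw [not_nonempty_iff] at hem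
      rw [SimpleGraph.minDegree_of_subsingleton] at hlt
      omega
    -- `H'` has as many vertices as `G`, hence so does `H`. So `H'` spans `H`, which gets degrees at
    -- least `k + 1` and is thus isomorphic to `G`.
    have hc := h W' H' hne (hH'.trans hH.1) hdeg
    classical
    obtain ⟨f, hf, he⟩ := hH'.exists_injective
    have hbij : Function.Bijective f :=
      (Fintype.bijective_iff_injective_and_card f).2
        ⟨hf, le_antisymm hH'.card_le (hH.1.card_le.trans hc)⟩
    have hHdeg : ∀ w, k + 1 ≤ H.degree w := fun w => by
      obtain ⟨w', rfl⟩ := hbij.2 w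
      exact (hdeg w').trans (degree_comp_le hf (he hbij.2) w')
    exact not_nonempty_iff.2 hH.2
      (hH.1.nonempty_iso (hc.trans hH'.card_le) hHdeg (fun v => (hG v).le))

end BlockStructure

namespace BlockStructure

/-! ### The construction -/

section Construction

variable {I C : Type}

/-- `T` is a tree with at least one edge, bipartite between `I` (the blocks) and `C` (the
cut-vertices), all of whose leaves are in `I`. -/
structure IsBlockCutTree (T : SimpleGraph (I ⊕ C)) : Prop where
  isTree : T.IsTree
  not_adj_inl : ∀ b b' : I, ¬ T.Adj (Sum.inl b) (Sum.inl b')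
  not_adj_inr : ∀ c c' : C, ¬ T.Adj (Sum.inr c) (Sum.inr c')
  exists_two : ∀ c, ∃ b b', b ≠ b' ∧ T.Adj (Sum.inl b) (Sum.inr c) ∧ T.Adj (Sum.inl b') (Sum.inr c)
  nonempty_cut : Nonempty C

variable (T : SimpleGraph (I ⊕ C))

/-- The vertices of the block `b` that are not cut-vertices: for each cut-vertex `c` of `b` some
vertices that are not joined to `c`, and some pairs of vertices that are not joined to each
other. -/
abbrev Inner (b : I) : Type :=
  (Σ c : {c : C // T.Adj (Sum.inl b) (Sum.inr c)},
      Fin (6 * (side T (Sum.inr c.1) (Sum.inl b)).ncard - 5)) ⊕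
    (Fin (2 * {c : C | T.Adj (Sum.inl b) (Sum.inr c)}.ncard + 1) × Bool)

/-- The vertices of the graph with block decomposition tree `T`. -/
abbrev Vertex : Type := C ⊕ Σ b : I, Inner T b

variable {T}

/-- The only vertex of its block that an inner vertex is not joined to. -/
def mate : (Σ b : I, Inner T b) → Vertex T
  | ⟨_, Sum.inl ⟨c, _⟩⟩ => Sum.inl c.1
  | ⟨b, Sum.inr (i, t)⟩ => Sum.inr ⟨b, Sum.inr (i, !t)⟩

/-- The vertex of `T` that a vertex of the graph is mapped to. -/
def proj : Vertex T → I ⊕ C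
  | Sum.inl c => Sum.inr c
  | Sum.inr p => Sum.inl p.1

variable (T) in
/-- The vertices of the block `b`. -/
def blockSet (b : I) : Set (Vertex T) := {v | proj v = Sum.inl b ∨ T.Adj (Sum.inl b) (proj v)}

variable (T) in
/-- The graph with block decomposition tree `T`. -/
def glued : SimpleGraph (Vertex T) where
  Adj u v := u ≠ v ∧ (∃ b, u ∈ blockSet T b ∧ v ∈ blockSet T b) ∧
    (∀ p, u = Sum.inr p → v ≠ mate p) ∧ (∀ p, v = Sum.inr p → u ≠ mate p)
  symm := ⟨fun _ _ ⟨h1, ⟨b, h2, h3⟩, h4, h5⟩ => ⟨h1.symm, ⟨b, h3, h2⟩, h5, h4⟩⟩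
  loopless := ⟨fun _ h => h.1 rfl⟩

lemma inl_mem_blockSet {b : I} {c : C} :
    (Sum.inl c : Vertex T) ∈ blockSet T b ↔ T.Adj (Sum.inl b) (Sum.inr c) := by
  simp [blockSet, proj]

lemma proj_eq_inr {v : Vertex T} {c : C} (h : proj v = Sum.inr c) : v = Sum.inl c := by
  cases v with
  | inl c' => simpa [proj] using h
  | inr p => simp [proj] at h

namespace IsBlockCutTree

lemma inr_mem_blockSet (hT : IsBlockCutTree T) {b : I} {p : Σ b : I, Inner T b} :
    (Sum.inr p : Vertex T) ∈ blockSet T b ↔ p.1 = b := by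
  simp [blockSet, proj, hT.not_adj_inl]

lemma mate_mem_blockSet (hT : IsBlockCutTree T) (p : Σ b : I, Inner T b) :
    mate p ∈ blockSet T p.1 := by
  obtain ⟨b, ⟨c, i⟩ | ⟨i, t⟩⟩ := p
  · exact inl_mem_blockSet.2 c.2
  · exact hT.inr_mem_blockSet.2 rfl

end IsBlockCutTree

lemma mate_ne (p : Σ b : I, Inner T b) : mate p ≠ Sum.inr p := by
  obtain ⟨b, ⟨c, i⟩ | ⟨i, t⟩⟩ := p <;> simp [mate]

lemma mate_symm {p q : Σ b : I, Inner T b} (h : mate p = Sum.inr q) : mate q = Sum.inr p := by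
  obtain ⟨b, ⟨c, i⟩ | ⟨i, t⟩⟩ := p
  · simp [mate] at h
  · simp only [mate, Sum.inr.injEq] at h
    subst h
    simp [mate]

namespace IsBlockCutTree

lemma adj_inr (hT : IsBlockCutTree T) {p : Σ b : I, Inner T b} {v : Vertex T} :
    (glued T).Adj (Sum.inr p) v ↔ v ∈ blockSet T p.1 ∧ v ≠ Sum.inr p ∧ v ≠ mate p := by
  constructor
  · rintro ⟨h1, ⟨b, h2, h3⟩, h4, -⟩
    rw [hT.inr_mem_blockSet] at h2
    subst h2
    exact ⟨h3, h1.symm, h4 p rfl⟩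
  · rintro ⟨h1, h2, h3⟩
    refine ⟨h2.symm, ⟨_, hT.inr_mem_blockSet.2 rfl, h1⟩, ?_, ?_⟩
    · rintro q hq
      rw [← Sum.inr_injective hq]
      exact h3
    · rintro q rfl hq
      exact h3 (mate_symm hq.symm).symm

lemma mem_side_of_mem_blockSet (hT : IsBlockCutTree T) {b : I} {c : C}
    (h : T.Adj (Sum.inl b) (Sum.inr c))
    {v : Vertex T} (hv : v ∈ blockSet T b) (hvc : v ≠ Sum.inl c) :
    proj v ∈ side T (Sum.inl b) (Sum.inr c) := by
  rcases hv with hv | hv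
  · rw [hv]
    exact self_mem_side h
  · refine (mem_side_or hT.isTree h _).resolve_right fun hs => hvc (proj_eq_inr ?_)
    exact (eq_of_adj_of_mem_side hT.isTree h hv (self_mem_side h) hs).2

/-- The only edges of the graph between the two sides of an edge `b c` of `T` are those that join
`c` to the block `b`. -/
lemma eq_of_adj_of_mem_side (hT : IsBlockCutTree T) {b : I} {c : C}
    (h : T.Adj (Sum.inl b) (Sum.inr c)) {u v : Vertex T} (huv : (glued T).Adj u v)
    (hu : proj u ∈ side T (Sum.inl b) (Sum.inr c))
    (hv : proj v ∉ side T (Sum.inl b) (Sum.inr c)) : v = Sum.inl c ∧ u ∈ blockSet T b := by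
  obtain ⟨-, ⟨b', hub, hvb⟩, -⟩ := huv
  have hv' := (mem_side_or hT.isTree h (proj v)).resolve_left hv
  by_cases hb : b' = b
  · subst hb
    refine ⟨?_, hub⟩
    by_contra hne
    exact hv (hT.mem_side_of_mem_blockSet h hvb hne)
  · exfalso
    rcases mem_side_or hT.isTree h (Sum.inl b') with hs | hs
    · rcases hvb with hvb | hvb
      · exact hv (hvb ▸ hs)
      · exact hb (Sum.inl_injective
          (BlockStructure.eq_of_adj_of_mem_side hT.isTree h hvb hs hv').1)
    · rcases hub with hub | hub
      · exact notMem_side hs (hub ▸ hu)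
      · exact Sum.inl_ne_inr
          (BlockStructure.eq_of_adj_of_mem_side hT.isTree h hub.symm hu hs).2

lemma notMem_side_of_mem_blockSet (hT : IsBlockCutTree T) {b b' : I} {c : C} (hb : b ≠ b')
    (h : T.Adj (Sum.inl b) (Sum.inr c)) (h' : T.Adj (Sum.inl b') (Sum.inr c))
    {v : Vertex T} (hv : v ∈ blockSet T b') : proj v ∉ side T (Sum.inl b) (Sum.inr c) := by
  intro hs
  by_cases hvc : v = Sum.inl c
  · subst hvc
    exact notMem_side (self_mem_side h.symm) hs
  · exact hb (Sum.inl_injective (eq_of_mem_side hT.isTree h.symm h'.symm hs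
      (hT.mem_side_of_mem_blockSet h' hv hvc)))

/-- An inner vertex determines its block. If `u` is a cut-vertex of two blocks, all other vertices
of one lie on its side of `u`, where the other has none. -/
lemma block_eq_of_mem (hT : IsBlockCutTree T) {b b' : I} {u v : Vertex T} (huv : u ≠ v)
    (hu : u ∈ blockSet T b) (hv : v ∈ blockSet T b) (hu' : u ∈ blockSet T b')
    (hv' : v ∈ blockSet T b') : b = b' := by
  cases u with
  | inr p =>
    rw [hT.inr_mem_blockSet] at hu hu'
    exact hu.symm.trans hu'
  | inl c =>
    by_contra hb
    rw [inl_mem_blockSet] at hu hu'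
    exact hT.notMem_side_of_mem_blockSet hb hu hu' hv' (hT.mem_side_of_mem_blockSet hu hv huv.symm)

lemma exists_adj_inl (hT : IsBlockCutTree T) (b : I) : ∃ c, T.Adj (Sum.inl b) (Sum.inr c) := by
  obtain ⟨c⟩ := hT.nonempty_cut
  obtain ⟨u, hu, -⟩ := exists_mem_side hT.isTree (x := Sum.inr c) (v := Sum.inl b) Sum.inr_ne_inl
  cases u with
  | inl b' => exact absurd hu (hT.not_adj_inl _ _)
  | inr c' => exact ⟨c', hu⟩

/-! ### Sizes of the sides and of the blocks -/

variable [Finite I] [Finite C]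

lemma sum_side_inl (hT : IsBlockCutTree T) (b : I)
    [Fintype {c : C // T.Adj (Sum.inl b) (Sum.inr c)}] :
    ∑ c : {c : C // T.Adj (Sum.inl b) (Sum.inr c)}, (side T (Sum.inr c.1) (Sum.inl b)).ncard =
      Nat.card (I ⊕ C) - 1 := by
  classical
  have := Fintype.ofFinite (I ⊕ C)
  rw [Nat.card_eq_fintype_card, ← sum_card_side hT.isTree (Sum.inl b)]
  refine Finset.sum_bij (fun c _ => Sum.inr c.1) (fun c _ => by simpa using c.2)
    (fun c _ c' _ h => Subtype.ext (Sum.inr_injective h)) (fun u hu => ?_)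
    (fun c _ => by rw [Set.ncard_eq_toFinset_card'])
  cases u with
  | inl b' => exact absurd (Finset.mem_filter.1 hu).2 (hT.not_adj_inl _ _)
  | inr c => exact ⟨⟨c, (Finset.mem_filter.1 hu).2⟩, Finset.mem_univ _, rfl⟩

lemma sum_side_inr (hT : IsBlockCutTree T) (c : C)
    [Fintype {b : I // T.Adj (Sum.inl b) (Sum.inr c)}] :
    ∑ b : {b : I // T.Adj (Sum.inl b) (Sum.inr c)}, (side T (Sum.inl b.1) (Sum.inr c)).ncard =
      Nat.card (I ⊕ C) - 1 := by
  classical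
  have := Fintype.ofFinite (I ⊕ C)
  rw [Nat.card_eq_fintype_card, ← sum_card_side hT.isTree (Sum.inr c)]
  refine Finset.sum_bij (fun b _ => Sum.inl b.1) (fun b _ => by simpa using b.2.symm)
    (fun b _ b' _ h => Subtype.ext (Sum.inl_injective h)) (fun u hu => ?_)
    (fun c _ => by rw [Set.ncard_eq_toFinset_card'])
  cases u with
  | inr c' => exact absurd (Finset.mem_filter.1 hu).2 (hT.not_adj_inr _ _)
  | inl b => exact ⟨⟨b, (Finset.mem_filter.1 hu).2.symm⟩, Finset.mem_univ _, rfl⟩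

lemma ncard_side_pos (b : I) (c : C) (h : T.Adj (Sum.inl b) (Sum.inr c)) :
    0 < (side T (Sum.inr c) (Sum.inl b)).ncard :=
  (Set.ncard_pos (Set.toFinite _)).2 ⟨_, self_mem_side h.symm⟩

lemma ncard_side_add (hT : IsBlockCutTree T) {b : I} {c : C} (h : T.Adj (Sum.inl b) (Sum.inr c)) :
    (side T (Sum.inl b) (Sum.inr c)).ncard + (side T (Sum.inr c) (Sum.inl b)).ncard =
      Nat.card (I ⊕ C) := by
  classical
  have := Fintype.ofFinite (I ⊕ C)
  rw [Nat.card_eq_fintype_card, ← card_side_add hT.isTree h, Set.ncard_eq_toFinset_card',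
    Set.ncard_eq_toFinset_card']

lemma two_le_card (hT : IsBlockCutTree T) : 2 ≤ Nat.card (I ⊕ C) := by
  obtain ⟨c⟩ := hT.nonempty_cut
  obtain ⟨b, -, -, h, -⟩ := hT.exists_two c
  have h1 := ncard_side_pos b c h
  have h2 : 0 < (side T (Sum.inl b) (Sum.inr c)).ncard :=
    (Set.ncard_pos (Set.toFinite _)).2 ⟨_, self_mem_side h⟩
  have := hT.ncard_side_add h
  omega

/-- The inner vertices and the cut-vertices of a block make up the block. -/
def blockEquiv (hT : IsBlockCutTree T) (b : I) :
    {c : C // T.Adj (Sum.inl b) (Sum.inr c)} ⊕ Inner T b ≃ blockSet T b where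
  toFun
    | Sum.inl c => ⟨Sum.inl c.1, inl_mem_blockSet.2 c.2⟩
    | Sum.inr p => ⟨Sum.inr ⟨b, p⟩, hT.inr_mem_blockSet.2 rfl⟩
  invFun
    | ⟨Sum.inl c, h⟩ => Sum.inl ⟨c, inl_mem_blockSet.1 h⟩
    | ⟨Sum.inr p, h⟩ => Sum.inr (hT.inr_mem_blockSet.1 h ▸ p.2)
  left_inv := by rintro (c | p) <;> rfl
  right_inv := by
    rintro ⟨c | ⟨b', p⟩, h⟩
    · rfl
    · obtain rfl := hT.inr_mem_blockSet.1 h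
      rfl

/-- With k cut-vertices in `b` and n vertices in `T`, the count is k + (6(n - 1) - 5k) + 2(2k + 1):
the pairs are numerous enough to cancel k. -/
lemma ncard_blockSet (hT : IsBlockCutTree T) (b : I) :
    (blockSet T b).ncard = 6 * (Nat.card (I ⊕ C) - 1) + 2 := by
  have := Fintype.ofFinite {c : C // T.Adj (Sum.inl b) (Sum.inr c)}
  rw [← Nat.card_coe_set_eq, ← Nat.card_congr (hT.blockEquiv b), Nat.card_sum, Nat.card_sum,
    Nat.card_sigma, Nat.card_prod, Nat.card_fin, ← hT.sum_side_inl b]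
  simp only [Nat.card_eq_fintype_card, Fintype.card_fin, Fintype.card_bool]
  -- Every side is nonempty, so the truncated subtraction of 5 is exact.
  have h1 : ∑ c : {c : C // T.Adj (Sum.inl b) (Sum.inr c)},
      (6 * (side T (Sum.inr c.1) (Sum.inl b)).ncard - 5) +
      5 * Fintype.card {c : C // T.Adj (Sum.inl b) (Sum.inr c)} =
      6 * ∑ c : {c : C // T.Adj (Sum.inl b) (Sum.inr c)},
        (side T (Sum.inr c.1) (Sum.inl b)).ncard := by
    rw [Finset.mul_sum, ← Finset.card_univ, mul_comm 5, ← smul_eq_mul (b := 5), ← Finset.sum_const,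
      ← Finset.sum_add_distrib]
    refine Finset.sum_congr rfl fun c _ => ?_
    have := ncard_side_pos b c.1 c.2
    omega
  have h2 : {c : C | T.Adj (Sum.inl b) (Sum.inr c)}.ncard =
      Fintype.card {c : C // T.Adj (Sum.inl b) (Sum.inr c)} := by
    rw [← Nat.card_coe_set_eq, ← Nat.card_eq_fintype_card]
    rfl
  omega

end IsBlockCutTree

end Construction

end BlockStructure

namespace BlockStructure

/-! ### The graph is regular -/

section Degrees

variable {I C : Type} {T : SimpleGraph (I ⊕ C)}

namespace IsBlockCutTree

lemma adj_inl_inl {b : I} {c c' : C} (h : T.Adj (Sum.inl b) (Sum.inr c))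
    (h' : T.Adj (Sum.inl b) (Sum.inr c')) (hc : c ≠ c') :
    (glued T).Adj (Sum.inl c) (Sum.inl c') :=
  ⟨fun h => hc (Sum.inl_injective h), ⟨b, inl_mem_blockSet.2 h, inl_mem_blockSet.2 h'⟩,
    fun _ h => (Sum.inl_ne_inr h).elim, fun _ h => (Sum.inl_ne_inr h).elim⟩

variable [Finite I] [Finite C]

lemma ncard_neighborSet_inr (hT : IsBlockCutTree T) (p : Σ b : I, Inner T b) :
    ((glued T).neighborSet (Sum.inr p)).ncard = 6 * (Nat.card (I ⊕ C) - 1) := by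
  have h : (glued T).neighborSet (Sum.inr p) = blockSet T p.1 \ {Sum.inr p, mate p} := by
    ext v
    simp only [SimpleGraph.mem_neighborSet, hT.adj_inr, Set.mem_sdiff, Set.mem_insert_iff,
      Set.mem_singleton_iff, not_or]
  have hsub : {Sum.inr p, mate p} ⊆ blockSet T p.1 := by
    rintro v (rfl | rfl)
    · exact hT.inr_mem_blockSet.2 rfl
    · exact hT.mate_mem_blockSet p
  rw [h, Set.ncard_sdiff hsub, hT.ncard_blockSet, Set.ncard_pair (mate_ne p).symm]
  omega

/-- Of the 6(n - 1) + 2 vertices of `b`, `c` misses itself and 6s - 5 others, where s is the size of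
its own side. This leaves 6(n - s). -/
lemma ncard_neighborSet_inter (hT : IsBlockCutTree T) {b : I} {c : C}
    (h : T.Adj (Sum.inl b) (Sum.inr c)) :
    ((glued T).neighborSet (Sum.inl c) ∩ blockSet T b).ncard =
      6 * (side T (Sum.inl b) (Sum.inr c)).ncard := by
  let leaf : Fin (6 * (side T (Sum.inr c) (Sum.inl b)).ncard - 5) → Vertex T :=
    fun i => Sum.inr ⟨b, Sum.inl ⟨⟨c, h⟩, i⟩⟩
  have hleaf : Function.Injective leaf := by
    intro i j hij
    simpa [leaf] using hij
  have heq : (glued T).neighborSet (Sum.inl c) ∩ blockSet T b =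
      blockSet T b \ insert (Sum.inl c) (Set.range leaf) := by
    ext v
    simp only [Set.mem_inter_iff, SimpleGraph.mem_neighborSet, Set.mem_sdiff, Set.mem_insert_iff,
      Set.mem_range, not_or, not_exists]
    rw [and_comm, and_congr_right_iff]
    intro hv
    rcases v with c' | ⟨b', p⟩
    · constructor
      · intro hadj
        exact ⟨hadj.ne', fun i hi => by simp [leaf] at hi⟩
      · rintro ⟨hne, -⟩
        exact adj_inl_inl h (inl_mem_blockSet.1 hv) (fun hc => hne (hc ▸ rfl))
    · obtain rfl : b' = b := hT.inr_mem_blockSet.1 hv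
      rw [SimpleGraph.adj_comm, hT.adj_inr]
      constructor
      · rintro ⟨-, -, hm⟩
        refine ⟨by simp, fun i hi => ?_⟩
        have := Sum.inr_injective hi
        rw [← this] at hm
        exact hm rfl
      · rintro ⟨-, hm⟩
        refine ⟨inl_mem_blockSet.2 h, by simp, fun hc => ?_⟩
        rcases p with ⟨⟨c', h'⟩, i⟩ | ⟨i, t⟩
        · obtain rfl : c = c' := by simpa [mate] using hc
          exact hm i rfl
        · simp [mate] at hc
  have hsub : insert (Sum.inl c) (Set.range leaf) ⊆ blockSet T b := by
    rintro v (rfl | ⟨i, rfl⟩)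
    · exact inl_mem_blockSet.2 h
    · exact hT.inr_mem_blockSet.2 rfl
  have hcard : (Set.range leaf).ncard = 6 * (side T (Sum.inr c) (Sum.inl b)).ncard - 5 := by
    rw [← Set.image_univ, Set.ncard_image_of_injective _ hleaf, Set.ncard_univ, Nat.card_fin]
  rw [heq, Set.ncard_sdiff hsub, hT.ncard_blockSet, Set.ncard_insert_of_notMem (by simp [leaf]),
    hcard]
  have := ncard_side_pos b c h
  have := hT.ncard_side_add h
  have := hT.two_le_card
  omega

/-- Blocks at `c` share only `c`, so the neighbours in them add up, and the sides seen from `c`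
partition the other vertices of `T`. -/
lemma ncard_neighborSet_inl (hT : IsBlockCutTree T) (c : C) :
    ((glued T).neighborSet (Sum.inl c)).ncard = 6 * (Nat.card (I ⊕ C) - 1) := by
  have := Fintype.ofFinite {b : I // T.Adj (Sum.inl b) (Sum.inr c)}
  let e : (Σ b : {b : I // T.Adj (Sum.inl b) (Sum.inr c)},
      ((glued T).neighborSet (Sum.inl c) ∩ blockSet T b.1 : Set (Vertex T))) →
      (glued T).neighborSet (Sum.inl c) := fun x => ⟨x.2.1, x.2.2.1⟩
  have he : Function.Bijective e := by
    constructor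
    · rintro ⟨⟨b, hb⟩, v, hv, hvb⟩ ⟨⟨b', hb'⟩, v', hv', hvb'⟩ h
      obtain rfl : v = v' := congrArg Subtype.val h
      obtain rfl : b = b' := hT.block_eq_of_mem ((glued T).ne_of_adj hv) (inl_mem_blockSet.2 hb)
        hvb (inl_mem_blockSet.2 hb') hvb'
      rfl
    · rintro ⟨v, hv⟩
      obtain ⟨-, ⟨b, hcb, hvb⟩, -⟩ := id hv
      exact ⟨⟨⟨b, inl_mem_blockSet.1 hcb⟩, v, hv, hvb⟩, rfl⟩
  rw [← Nat.card_coe_set_eq, ← Nat.card_congr (Equiv.ofBijective e he), Nat.card_sigma,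
    ← hT.sum_side_inr c, Finset.mul_sum]
  exact Finset.sum_congr rfl fun b _ => by
    rw [Nat.card_coe_set_eq, hT.ncard_neighborSet_inter b.2]

lemma degree_eq (hT : IsBlockCutTree T) [Fintype (Vertex T)] [DecidableRel (glued T).Adj]
    (v : Vertex T) : (glued T).degree v = 6 * (Nat.card (I ⊕ C) - 1) := by
  have h : (glued T).degree v = ((glued T).neighborSet v).ncard := by
    rw [Set.ncard_eq_toFinset_card', ← SimpleGraph.card_neighborFinset_eq_degree]
    rfl
  rw [h]
  cases v with
  | inl c => exact hT.ncard_neighborSet_inl c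
  | inr p => exact hT.ncard_neighborSet_inr p

end IsBlockCutTree

end Degrees

end BlockStructure

namespace BlockStructure

/-! ### Minimality -/

section Minimality

variable {I C : Type} {T : SimpleGraph (I ⊕ C)} {W : Type} {H : SimpleGraph W}
  {B : W → Set (Vertex T)}

/-- The vertices of the block `b` are in distinct branch sets. -/
def IsFull (B : W → Set (Vertex T)) (b : I) : Prop :=
  (∀ v ∈ blockSet T b, ∃ w, v ∈ B w) ∧
    ∀ w, ∀ v ∈ blockSet T b, ∀ v' ∈ blockSet T b, v ∈ B w → v' ∈ B w → v = v'

/-- The branch sets that meet the block `b`. -/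
def meets (B : W → Set (Vertex T)) (b : I) : Set W := {w | ∃ v ∈ blockSet T b, v ∈ B w}

variable (H B) in
/-- The sets `B w` are branch sets of a minor `H` of the graph. -/
structure IsModel : Prop where
  connected : ∀ w, ((glued T).induce (B w)).Connected
  eq_of_mem : ∀ {w w' v}, v ∈ B w → v ∈ B w' → w = w'
  exists_adj : ∀ {w w'}, H.Adj w w' → ∃ x ∈ B w, ∃ y ∈ B w', (glued T).Adj x y

namespace IsBlockCutTree

lemma subset_singleton (hT : IsBlockCutTree T) {S : Set (Vertex T)}
    (hS : ((glued T).induce S).Connected) {p : Σ b : I, Inner T b} (hp : Sum.inr p ∈ S)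
    (h : ∀ v ∈ blockSet T p.1, v ∈ S → v = Sum.inr p) : ∀ v ∈ S, v = Sum.inr p := by
  intro v hv
  by_contra hne
  obtain ⟨u, -, z, hz, huz, rfl, hzA⟩ :=
    exists_adj_boundary hS hp (Set.mem_singleton (Sum.inr p)) hv hne
  exact hzA (h z (hT.adj_inr.1 huz).1 hz)

lemma subset_blockSet (hT : IsBlockCutTree T) {S : Set (Vertex T)}
    (hS : ((glued T).induce S).Connected) {b : I} {v : Vertex T} (hv : v ∈ S)
    (hvb : v ∈ blockSet T b) (h : ∀ c, T.Adj (Sum.inl b) (Sum.inr c) → Sum.inl c ∉ S) :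
    S ⊆ blockSet T b := by
  intro y hy
  by_contra hyb
  obtain ⟨u, hu, z, -, huz, hub, hzb⟩ := exists_adj_boundary hS hv hvb hy hyb
  cases u with
  | inl c => exact h c (inl_mem_blockSet.1 hub) hu
  | inr p =>
    obtain rfl := hT.inr_mem_blockSet.1 hub
    exact hzb (hT.adj_inr.1 huz).1

/-- To reach that side, the connected set `B w` would have to use an edge from `c` to another vertex
of `b`, but fullness allows it only one vertex of `b`. -/
lemma notMem_side_of_isFull (hT : IsBlockCutTree T) (hB : IsModel H B) {b : I} {c : C}
    (h : T.Adj (Sum.inl b) (Sum.inr c)) (hb : IsFull B b) {w : W} (hw : Sum.inl c ∈ B w)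
    {v : Vertex T} (hv : v ∈ B w) : proj v ∉ side T (Sum.inl b) (Sum.inr c) := by
  intro hvs
  have hc : proj (Sum.inl c : Vertex T) ∉ side T (Sum.inl b) (Sum.inr c) :=
    notMem_side (self_mem_side h.symm)
  obtain ⟨u, hu, z, -, huz, hus, hzs⟩ := exists_adj_boundary (hB.connected w)
    (A := {u | proj u ∈ side T (Sum.inl b) (Sum.inr c)}) hv hvs hw hc
  have hub := (hT.eq_of_adj_of_mem_side h huz hus hzs).2
  rw [hb.2 w _ (inl_mem_blockSet.2 h) u hub hw hu] at hc
  exact hc hus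

lemma exists_mem_blockSet (hT : IsBlockCutTree T) (v : Vertex T) : ∃ b, v ∈ blockSet T b := by
  cases v with
  | inl c =>
    obtain ⟨b, -, -, h, -⟩ := hT.exists_two c
    exact ⟨b, inl_mem_blockSet.2 h⟩
  | inr p => exact ⟨p.1, hT.inr_mem_blockSet.2 rfl⟩

variable [Finite C]

/-- As `b` has a cut-vertex, it has at least three pairs, and two vertices spoil at most two of
them. -/
lemma exists_pair_avoiding (hT : IsBlockCutTree T) (b : I) (z v : Vertex T) :
    ∃ i, ∀ t, (Sum.inr ⟨b, Sum.inr (i, t)⟩ : Vertex T) ≠ z ∧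
      (Sum.inr ⟨b, Sum.inr (i, t)⟩ : Vertex T) ≠ v := by
  by_contra! h
  obtain ⟨c, hc⟩ := hT.exists_adj_inl b
  have hpos : 0 < {c : C | T.Adj (Sum.inl b) (Sum.inr c)}.ncard :=
    (Set.ncard_pos (Set.toFinite _)).2 ⟨c, hc⟩
  have key : ∀ i j t s, (Sum.inr ⟨b, Sum.inr (i, t)⟩ : Vertex T) =
      Sum.inr ⟨b, Sum.inr (j, s)⟩ → i = j := by
    intro i j t s h
    simp only [Sum.inr.injEq, Sigma.mk.injEq, heq_eq_eq, Prod.mk.injEq, true_and] at h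
    exact h.1
  have hz : ∀ i, ∃ t, (Sum.inr ⟨b, Sum.inr (i, t)⟩ : Vertex T) = z ∨
      (Sum.inr ⟨b, Sum.inr (i, t)⟩ : Vertex T) = v := by
    intro i
    obtain ⟨t, ht⟩ := h i
    exact ⟨t, or_iff_not_imp_left.2 ht⟩
  obtain ⟨t₀, h₀⟩ := hz ⟨0, by omega⟩
  obtain ⟨t₁, h₁⟩ := hz ⟨1, by omega⟩
  obtain ⟨t₂, h₂⟩ := hz ⟨2, by omega⟩
  have h01 : ¬ ((⟨0, by omega⟩ : Fin (2 * {c : C | T.Adj (Sum.inl b) (Sum.inr c)}.ncard + 1)) =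
    ⟨1, by omega⟩) := by simp
  have h02 : ¬ ((⟨0, by omega⟩ : Fin (2 * {c : C | T.Adj (Sum.inl b) (Sum.inr c)}.ncard + 1)) =
    ⟨2, by omega⟩) := by simp
  have h12 : ¬ ((⟨1, by omega⟩ : Fin (2 * {c : C | T.Adj (Sum.inl b) (Sum.inr c)}.ncard + 1)) =
    ⟨2, by omega⟩) := by simp
  rcases h₀ with h₀ | h₀ <;> rcases h₁ with h₁ | h₁ <;> rcases h₂ with h₂ | h₂ <;>
    first
    | exact h01 (key _ _ _ _ (h₀.trans h₁.symm))
    | exact h02 (key _ _ _ _ (h₀.trans h₂.symm))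
    | exact h12 (key _ _ _ _ (h₁.trans h₂.symm))

variable [Finite I]

/-- `B w` lies inside `b`, so `w` and its neighbours give at least d + 1 branch sets meeting the d +
2 vertices of `b`. If only one vertex is left over, some pair lies in two branch sets that have no
other vertex in `b`. These two are not adjacent, and each has at most d - 1 neighbours. -/
lemma isFull_of_forall_notMem [Finite W] (hT : IsBlockCutTree T) (hB : IsModel H B)
    (hH : ∀ w, 6 * (Nat.card (I ⊕ C) - 1) ≤ (H.neighborSet w).ncard) {b : I} {w : W}
    (hw : w ∈ meets B b) (h : ∀ c, T.Adj (Sum.inl b) (Sum.inr c) → Sum.inl c ∉ B w) :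
    IsFull B b := by
  have hd := hT.two_le_card
  have hVb := hT.ncard_blockSet b
  have hcard : 6 * (Nat.card (I ⊕ C) - 1) + 1 ≤ (meets B b).ncard := by
    have hsub : insert w (H.neighborSet w) ⊆ meets B b := by
      rintro w' (rfl | hw')
      · exact hw
      · obtain ⟨v, hvb, hv⟩ := hw
        have hs := hT.subset_blockSet (hB.connected w) hv hvb h
        obtain ⟨x, hx, y, hy, hxy⟩ := hB.exists_adj hw'
        rcases x with c | p
        · exact absurd hx (h c (inl_mem_blockSet.1 (hs hx)))
        · obtain rfl := hT.inr_mem_blockSet.1 (hs hx)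
          exact ⟨y, (hT.adj_inr.1 hxy).1, hy⟩
    refine le_trans ?_ (Set.ncard_le_ncard hsub)
    rw [Set.ncard_insert_of_notMem (by simp)]
    exact Nat.succ_le_succ (hH w)
  have : Nonempty (Vertex T) := ⟨hw.choose⟩
  choose! g hgb hg using fun w (hw : w ∈ meets B b) => hw
  have hinj : Set.InjOn g (meets B b) := fun w₁ h₁ w₂ h₂ h =>
    hB.eq_of_mem (hg w₁ h₁) (h ▸ hg w₂ h₂)
  have hR : (g '' meets B b).ncard = (meets B b).ncard := hinj.ncard_image
  have hRsub : g '' meets B b ⊆ blockSet T b := Set.image_subset_iff.2 hgb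
  by_cases hall : blockSet T b ⊆ g '' meets B b
  · refine ⟨fun v hv => ?_, fun w' v hv v' hv' hvw hvw' => ?_⟩
    · obtain ⟨w', hw', rfl⟩ := hall hv
      exact ⟨w', hg w' hw'⟩
    · obtain ⟨w₁, h₁, rfl⟩ := hall hv
      obtain ⟨w₂, h₂, rfl⟩ := hall hv'
      rw [hB.eq_of_mem (hg w₁ h₁) hvw, hB.eq_of_mem (hg w₂ h₂) hvw']
  · exfalso
    obtain ⟨z, hzb, hz⟩ := Set.not_subset.1 hall
    have hRz : g '' meets B b = blockSet T b \ {z} := by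
      refine Set.eq_of_subset_of_ncard_le
        (fun u hu => ⟨hRsub hu, fun huz => hz (huz ▸ hu)⟩) ?_
      rw [Set.ncard_sdiff_singleton_of_mem hzb]
      omega
    have hRcard : (meets B b).ncard = 6 * (Nat.card (I ⊕ C) - 1) + 1 := by
      rw [← hR, hRz, Set.ncard_sdiff_singleton_of_mem hzb]
      omega
    -- `v` represents the branch set containing the left-over vertex `z`; if there is none, any
    -- value does.
    obtain ⟨v, hv⟩ : ∃ v, ∀ w, z ∈ B w → g w = v := by
      by_cases hex : ∃ w, z ∈ B w
      · obtain ⟨w₁, h₁⟩ := hex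
        exact ⟨g w₁, fun w₂ h₂ => by rw [hB.eq_of_mem h₁ h₂]⟩
      · exact ⟨z, fun w₂ h₂ => absurd ⟨w₂, h₂⟩ hex⟩
    obtain ⟨i, hi⟩ := hT.exists_pair_avoiding b z v
    have hrep : ∀ t, ∃ w' ∈ meets B b, g w' = Sum.inr ⟨b, Sum.inr (i, t)⟩ ∧
        ∀ u ∈ blockSet T b, u ∈ B w' → u = Sum.inr ⟨b, Sum.inr (i, t)⟩ := by
      intro t
      have hmem : (Sum.inr ⟨b, Sum.inr (i, t)⟩ : Vertex T) ∈ g '' meets B b := by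
        rw [hRz]
        exact ⟨hT.inr_mem_blockSet.2 rfl, (hi t).1⟩
      obtain ⟨w', hw', hgw'⟩ := hmem
      refine ⟨w', hw', hgw', fun u hub hu => ?_⟩
      by_cases huz : u = z
      · subst huz
        exact absurd (hgw'.symm.trans (hv w' hu)) (hi t).2
      · have huR : u ∈ g '' meets B b := by
          rw [hRz]
          exact ⟨hub, huz⟩
        obtain ⟨w₂, h₂, rfl⟩ := huR
        rw [← hgw', hB.eq_of_mem (hg w₂ h₂) hu]
    obtain ⟨x, hx, hgx, hxB⟩ := hrep true
    obtain ⟨y, hy, hgy, hyB⟩ := hrep false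
    have hxy : x ≠ y := by
      rintro rfl
      rw [hgx] at hgy
      simp at hgy
    have hsingle := hT.subset_singleton (hB.connected x) (hgx ▸ hg x hx) hxB
    have hsub : H.neighborSet x ⊆ meets B b \ {x, y} := by
      intro w' hw'
      obtain ⟨u, hu, u', hu', huu'⟩ := hB.exists_adj hw'
      rw [hsingle u hu, hT.adj_inr] at huu'
      refine ⟨⟨u', huu'.1, hu'⟩, ?_⟩
      rintro (rfl | rfl)
      · exact H.loopless.irrefl _ hw'
      · exact huu'.2.2 (hyB u' huu'.1 hu')
    have h1 := Set.ncard_le_ncard hsub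
    rw [Set.ncard_sdiff (Set.insert_subset hx (Set.singleton_subset_iff.2 hy)), Set.ncard_pair hxy]
      at h1
    have := hH x
    omega

/-- Suppose not. Behind each full block at a cut-vertex in `B w` lies a side of `T` that `B w` does
not enter, and it accounts for at most 6 neighbours of `w` per vertex. Every other neighbour meets a
non-full block and so contains one of its cut-vertices, which belongs to the remaining part `X` of
`T`. As `X` contains both `c` and `b`, the total falls short of d. -/
lemma isFull_of_mem [Finite W] (hT : IsBlockCutTree T) (hB : IsModel H B)
    (hH : ∀ w, 6 * (Nat.card (I ⊕ C) - 1) ≤ (H.neighborSet w).ncard) {b : I} {c : C} {w : W}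
    (hw : Sum.inl c ∈ B w) (h : T.Adj (Sum.inl b) (Sum.inr c)) : IsFull B b := by
  by_contra hb
  let F : Type := {f : C × I //
    Sum.inl f.1 ∈ B w ∧ T.Adj (Sum.inl f.2) (Sum.inr f.1) ∧ IsFull B f.2}
  let sd : F → Set (I ⊕ C) := fun f => side T (Sum.inl f.1.2) (Sum.inr f.1.1)
  let X : Set (I ⊕ C) := (⋃ f : F, sd f)ᶜ
  have hXc : ∀ c, Sum.inl c ∈ B w → Sum.inr c ∈ X := by
    intro c₁ h₁ hmem
    obtain ⟨f, hf⟩ := Set.mem_iUnion.1 hmem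
    exact hT.notMem_side_of_isFull hB f.2.2.1 f.2.2.2 f.2.1 h₁ hf
  have hXb : ∀ b₁, ¬ IsFull B b₁ → w ∈ meets B b₁ → Sum.inl b₁ ∈ X ∧
      ∀ c₂, T.Adj (Sum.inl b₁) (Sum.inr c₂) → Sum.inr c₂ ∈ X := by
    intro b₁ hb₁ hw₁
    obtain ⟨c₃, h₃, hc₃⟩ : ∃ c₃, T.Adj (Sum.inl b₁) (Sum.inr c₃) ∧ Sum.inl c₃ ∈ B w := by
      by_contra! hno
      exact hb₁ (hT.isFull_of_forall_notMem hB hH hw₁ hno)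
    have hb₁s : ∀ f : F, Sum.inl b₁ ∉ sd f := by
      intro f hs
      have h4 := hT.notMem_side_of_isFull hB f.2.2.1 f.2.2.2 f.2.1 hc₃
      have h5 := BlockStructure.eq_of_adj_of_mem_side hT.isTree f.2.2.1 h₃ hs
        ((mem_side_or hT.isTree f.2.2.1 _).resolve_left h4)
      exact hb₁ (Sum.inl_injective h5.1 ▸ f.2.2.2)
    refine ⟨fun hmem => ?_, fun c₂ h₂ hmem => ?_⟩
    · obtain ⟨f, hf⟩ := Set.mem_iUnion.1 hmem
      exact hb₁s f hf
    · obtain ⟨f, hf⟩ := Set.mem_iUnion.1 hmem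
      have h5 := BlockStructure.eq_of_adj_of_mem_side hT.isTree f.2.2.1 h₂.symm hf
        ((mem_side_or hT.isTree f.2.2.1 _).resolve_left (hb₁s f))
      exact Sum.inr_ne_inl h5.1
  -- From a common vertex `x` of two such sides, each of the two cut-vertices would lie on the path
  -- to the other, so they coincide.
  have hdisj : ∀ f f' : F, ∀ x, x ∈ sd f → x ∈ sd f' → f = f' := by
    intro f f' x hx hx'
    have h1 := hT.notMem_side_of_isFull hB f.2.2.1 f.2.2.2 f.2.1 f'.2.1
    have h2 := hT.notMem_side_of_isFull hB f'.2.2.1 f'.2.2.2 f'.2.1 f.2.1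
    have h3 := dist_add_of_mem_side hT.isTree f.2.2.1 hx
      ((mem_side_or hT.isTree f.2.2.1 _).resolve_left h1)
    have h4 := dist_add_of_mem_side hT.isTree f'.2.2.1 hx'
      ((mem_side_or hT.isTree f'.2.2.1 _).resolve_left h2)
    simp only [proj] at h3 h4
    have h5 : f.1.1 = f'.1.1 := Sum.inr_injective (hT.isTree.connected.dist_eq_zero_iff.1
      (show T.dist (Sum.inr f.1.1) (Sum.inr f'.1.1) = 0 by omega))
    refine Subtype.ext (Prod.ext h5 (Sum.inl_injective
      (eq_of_mem_side hT.isTree f.2.2.1.symm (h5 ▸ f'.2.2.1.symm) hx ?_)))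
    rw [h5]
    exact hx'
  have hUX : (⋃ f : F, sd f).ncard + X.ncard = Nat.card (I ⊕ C) := Set.ncard_add_ncard_compl _
  have hX2 : 2 ≤ X.ncard := by
    rw [← Set.ncard_pair (show (Sum.inr c : I ⊕ C) ≠ Sum.inl b from Sum.inr_ne_inl)]
    exact Set.ncard_le_ncard (Set.insert_subset (hXc c hw)
      (Set.singleton_subset_iff.2 (hXb b hb ⟨_, inl_mem_blockSet.2 h, hw⟩).1))
  let N : F → Set (Vertex T) := fun f => (glued T).neighborSet (Sum.inl f.1.1) ∩ blockSet T f.1.2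
  let N₁ : Set W := {w' | ∃ f : F, ∃ y ∈ N f, y ∈ B w'}
  let N₂ : Set W := {w' | ∃ c' : C, (Sum.inr c' ∈ X \ {Sum.inr c}) ∧ Sum.inl c' ∈ B w'}
  have hsub : H.neighborSet w ⊆ N₁ ∪ N₂ := by
    intro w' hw'
    obtain ⟨x, hx, y, hy, hxy⟩ := hB.exists_adj hw'
    obtain ⟨-, ⟨b₁, hxb, hyb⟩, -⟩ := id hxy
    by_cases hb₁ : IsFull B b₁
    · left
      rcases x with c₁ | p
      · exact ⟨⟨(c₁, b₁), hx, inl_mem_blockSet.1 hxb, hb₁⟩, y, ⟨hxy, hyb⟩, hy⟩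
      · obtain rfl := hT.inr_mem_blockSet.1 hxb
        exact absurd (hT.subset_singleton (hB.connected w) hx
          (fun v hv hvw => hb₁.2 w v hv _ hxb hvw hx) _ hw) Sum.inl_ne_inr
    · right
      obtain ⟨c₂, h₂, hc₂⟩ : ∃ c₂, T.Adj (Sum.inl b₁) (Sum.inr c₂) ∧ Sum.inl c₂ ∈ B w' := by
        by_contra! hno
        exact hb₁ (hT.isFull_of_forall_notMem hB hH ⟨y, hyb, hy⟩ hno)
      refine ⟨c₂, ⟨(hXb b₁ hb₁ ⟨x, hxb, hx⟩).2 c₂ h₂, ?_⟩, hc₂⟩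
      rintro hcc
      obtain rfl := Sum.inr_injective hcc
      exact H.ne_of_adj hw' (hB.eq_of_mem hw hc₂)
  have h₁ : N₁.ncard ≤ 6 * (⋃ f : F, sd f).ncard := by
    have : Fintype F := Fintype.ofFinite F
    have hle : N₁.ncard ≤ Nat.card (Σ f : F, N f) := by
      choose f y hy hyB using fun w' : N₁ => w'.2
      rw [← Nat.card_coe_set_eq]
      refine Nat.card_le_card_of_injective
        (fun w' : N₁ => (⟨f w', y w', hy w'⟩ : Σ f : F, N f)) fun w₁ w₂ h => ?_
      have : y w₁ = y w₂ := congrArg (fun s : Σ f : F, N f => s.2.1) h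
      exact Subtype.ext (hB.eq_of_mem (hyB w₁) (this ▸ hyB w₂))
    have hle' : Nat.card (Σ f : F, sd f) ≤ (⋃ f : F, sd f).ncard := by
      rw [← Nat.card_coe_set_eq]
      refine Nat.card_le_card_of_injective
        (fun s : Σ f : F, sd f => (⟨s.2.1, Set.mem_iUnion.2 ⟨s.1, s.2.2⟩⟩ : (⋃ f : F, sd f : Set _)))
        ?_
      rintro ⟨f, x, hx⟩ ⟨f', x', hx'⟩ h
      obtain rfl : x = x' := congrArg Subtype.val h
      obtain rfl := hdisj f f' x hx hx'
      rfl
    refine hle.trans (le_trans (le_of_eq ?_) (Nat.mul_le_mul_left 6 hle'))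
    rw [Nat.card_sigma, Nat.card_sigma, Finset.mul_sum]
    refine Finset.sum_congr rfl fun f _ => ?_
    rw [Nat.card_coe_set_eq, Nat.card_coe_set_eq, hT.ncard_neighborSet_inter f.2.2.1]
  have h₂ : N₂.ncard ≤ X.ncard - 1 := by
    rw [← Set.ncard_sdiff_singleton_of_mem (hXc c hw), ← Nat.card_coe_set_eq,
      ← Nat.card_coe_set_eq]
    choose c' hc' hB' using fun w' : N₂ => w'.2
    refine Nat.card_le_card_of_injective
      (fun w' : N₂ => (⟨Sum.inr (c' w'), hc' w'⟩ : (X \ {Sum.inr c} : Set (I ⊕ C))))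
      fun w₁ w₂ h => ?_
    have : c' w₁ = c' w₂ := Sum.inr_injective (congrArg Subtype.val h)
    exact Subtype.ext (hB.eq_of_mem (hB' w₁) (this ▸ hB' w₂))
  -- The bound is 6(n - |X|) + |X| - 1, which is less than 6(n - 1) because |X| ≥ 2.
  have h3 := Set.ncard_le_ncard hsub
  have h4 := Set.ncard_union_le N₁ N₂
  have := hH w
  omega

/-- Otherwise each branch set contains a cut-vertex, and the minor has fewer than n vertices, too
few for its degrees. -/
lemma exists_isFull [Finite W] [Nonempty W] (hT : IsBlockCutTree T) (hB : IsModel H B)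
    (hH : ∀ w, 6 * (Nat.card (I ⊕ C) - 1) ≤ (H.neighborSet w).ncard) : ∃ b, IsFull B b := by
  by_contra! hno
  have hcut : ∀ w, ∃ c, Sum.inl c ∈ B w := by
    intro w
    obtain ⟨v, hv⟩ := (connected_induce_iff_boundary.1 (hB.connected w)).1
    obtain ⟨b, hb⟩ := hT.exists_mem_blockSet v
    by_contra! hc
    exact hno b (hT.isFull_of_forall_notMem hB hH ⟨v, hb, hv⟩ fun c _ => hc c)
  choose c hc using hcut
  have h1 : Nat.card W ≤ Nat.card C := Nat.card_le_card_of_injective c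
    fun w w' h => hB.eq_of_mem (hc w) (h ▸ hc w')
  obtain ⟨w⟩ := ‹Nonempty W›
  have h2 := hH w
  have h3 : (H.neighborSet w).ncard ≤ Nat.card W := by
    rw [← Set.ncard_univ]
    exact Set.ncard_le_ncard (Set.subset_univ _)
  obtain ⟨b, -⟩ := hT.exists_two (c w)
  have : Nonempty I := ⟨b⟩
  have h4 : 0 < Nat.card I := Nat.card_pos
  have h5 := Nat.card_sum (α := I) (β := C)
  have := hT.two_le_card
  omega

/-- The cut-vertices of a full block all lie in branch sets, which makes the other blocks at them
full; `T` is connected. -/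
lemma forall_isFull [Finite W] [Nonempty W] (hT : IsBlockCutTree T) (hB : IsModel H B)
    (hH : ∀ w, 6 * (Nat.card (I ⊕ C) - 1) ≤ (H.neighborSet w).ncard) (b : I) : IsFull B b := by
  obtain ⟨b₀, h₀⟩ := hT.exists_isFull hB hH
  by_contra hb
  let A : Set (I ⊕ C) := {x | (∃ b, x = Sum.inl b ∧ IsFull B b) ∨
    ∃ b c, x = Sum.inr c ∧ T.Adj (Sum.inl b) (Sum.inr c) ∧ IsFull B b}
  obtain ⟨p⟩ := hT.isTree.connected.preconnected (Sum.inl b₀) (Sum.inl b)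
  obtain ⟨⟨⟨x, y⟩, hadj⟩, -, hx, hy⟩ := p.exists_boundary_dart A (Or.inl ⟨b₀, rfl, h₀⟩) (by
    rintro (⟨b', h, h'⟩ | ⟨b', c, h, -⟩)
    · exact hb (Sum.inl_injective h ▸ h')
    · exact Sum.inl_ne_inr h)
  rcases hx with ⟨b₁, rfl, h₁⟩ | ⟨b₁, c, rfl, hbc, h₁⟩
  · cases y with
    | inl b₂ => exact hT.not_adj_inl _ _ hadj
    | inr c => exact hy (Or.inr ⟨b₁, c, rfl, hadj, h₁⟩)
  · cases y with
    | inr c' => exact hT.not_adj_inr _ _ hadj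
    | inl b₂ =>
      obtain ⟨w, hw⟩ := h₁.1 _ (inl_mem_blockSet.2 hbc)
      exact hy (Or.inl ⟨b₂, rfl, hT.isFull_of_mem hB hH hw hadj.symm⟩)

lemma card_le_of_isModel [Finite W] [Nonempty W] (hT : IsBlockCutTree T) (hB : IsModel H B)
    (hH : ∀ w, 6 * (Nat.card (I ⊕ C) - 1) ≤ (H.neighborSet w).ncard) :
    Nat.card (Vertex T) ≤ Nat.card W := by
  have hfull := hT.forall_isFull hB hH
  have hcov : ∀ v, ∃ w, v ∈ B w := fun v => by
    obtain ⟨b, hb⟩ := hT.exists_mem_blockSet v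
    exact (hfull b).1 v hb
  choose f hf using hcov
  refine Nat.card_le_card_of_injective f fun v v' h => ?_
  by_contra hne
  -- A branch set with two vertices would contain an edge, whose ends lie in a common full block.
  obtain ⟨u, hu, z, hz, huz, rfl, hzA⟩ := exists_adj_boundary (hB.connected (f v)) (hf v)
    (Set.mem_singleton v) (h ▸ hf v') (fun hv => hne (Set.mem_singleton_iff.1 hv).symm)
  obtain ⟨-, ⟨b, hub, hzb⟩, -⟩ := huz
  exact hzA ((hfull b).2 _ z hzb u hub hz hu)

lemma memDHat_glued (hT : IsBlockCutTree T) [Fintype (Vertex T)] [DecidableRel (glued T).Adj] :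
    (glued T).minDegree = 6 * (Nat.card (I ⊕ C) - 1) ∧
      MemDHat (6 * (Nat.card (I ⊕ C) - 1) - 1) (glued T) := by
  have h2 := hT.two_le_card
  have hk : 6 * (Nat.card (I ⊕ C) - 1) = 6 * (Nat.card (I ⊕ C) - 1) - 1 + 1 := by omega
  obtain ⟨c⟩ := hT.nonempty_cut
  have : Nonempty (Vertex T) := ⟨Sum.inl c⟩
  have key := memDHat_of_card_le (G := glued T) (k := 6 * (Nat.card (I ⊕ C) - 1) - 1)
    (fun v => (hT.degree_eq v).trans hk) ?_
  · exact ⟨key.1.trans hk.symm, key.2⟩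
  · rintro W _ H _ _ ⟨B, hB, hd, he⟩ hH
    rw [← Nat.card_eq_fintype_card, ← Nat.card_eq_fintype_card]
    have hmodel : IsModel H B := by
      refine ⟨hB, fun {w w' v} h h' => ?_, fun {w w'} => he w w'⟩
      by_contra hne
      exact Set.disjoint_left.1 (hd w w' hne) h h'
    refine hT.card_le_of_isModel hmodel fun w => ?_
    have : H.degree w = (H.neighborSet w).ncard := by
      rw [Set.ncard_eq_toFinset_card', ← SimpleGraph.card_neighborFinset_eq_degree]
      rfl
    rw [← this, hk]
    exact hH w

end IsBlockCutTree

end Minimality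

end BlockStructure

namespace BlockStructure

/-! ### The blocks and the cut-vertices of the graph -/

section BlockTree

variable {I C : Type} {T : SimpleGraph (I ⊕ C)}

variable (T) in
/-- The subgraph induced by the block `b`. -/
def blockSubgraph (b : I) : (glued T).Subgraph := (⊤ : (glued T).Subgraph).induce (blockSet T b)

/-- An inner vertex of the block `b`. -/
noncomputable def innerVertex (b : I) : Vertex T := Sum.inr ⟨b, Sum.inr (0, true)⟩

namespace IsBlockCutTree

/-- If no edge of `S` leaves `Z`, each block is inside or outside `Z` as far as `S` goes, and the
cut-vertices carry this along `T`. It is applied to the whole graph and to the graph minus an inner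
vertex. -/
lemma connected_induce_of_forall_block (hT : IsBlockCutTree T) {S : Set (Vertex T)}
    (hne : S.Nonempty) (hcut : ∀ c, Sum.inl c ∈ S)
    (h : ∀ b, ((glued T).induce (S ∩ blockSet T b)).Connected) :
    ((glued T).induce S).Connected := by
  rw [connected_induce_iff_boundary]
  refine ⟨hne, ?_⟩
  rintro Z ⟨x, hx, hxZ⟩ ⟨y, hy, hyZ⟩
  by_contra hno
  have hall : ∀ b, ∀ u ∈ S, u ∈ blockSet T b → u ∈ Z → S ∩ blockSet T b ⊆ Z := by
    intro b u hu hub huZ v hv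
    by_contra hvZ
    obtain ⟨s, hs, t, ht, hst⟩ := exists_adj_boundary (h b) ⟨hu, hub⟩ huZ hv hvZ
    exact hno ⟨s, hs.1, t, ht.1, hst⟩
  let Q : I ⊕ C → Prop := Sum.elim (fun b => S ∩ blockSet T b ⊆ Z) (fun c => Sum.inl c ∈ Z)
  obtain ⟨b₀, hb₀⟩ := hT.exists_mem_blockSet x
  obtain ⟨b₁, hb₁⟩ := hT.exists_mem_blockSet y
  obtain ⟨p⟩ := hT.isTree.connected.preconnected (Sum.inl b₀) (Sum.inl b₁)
  obtain ⟨⟨⟨s, t⟩, hadj⟩, -, hs, ht⟩ := p.exists_boundary_dart {t | Q t}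
    (hall b₀ x hx hb₀ hxZ) (fun hQ => hyZ (hQ ⟨hy, hb₁⟩))
  rcases s with b | c <;> rcases t with b' | c'
  · exact hT.not_adj_inl _ _ hadj
  · exact ht (hs ⟨hcut c', inl_mem_blockSet.2 hadj⟩)
  · exact ht (hall b' _ (hcut c) (inl_mem_blockSet.2 hadj.symm) hs)
  · exact hT.not_adj_inr _ _ hadj

lemma innerVertex_mem_blockSet (hT : IsBlockCutTree T) {b b' : I} :
    (innerVertex b : Vertex T) ∈ blockSet T b' ↔ b = b' :=
  hT.inr_mem_blockSet

lemma blockSubgraph_injective (hT : IsBlockCutTree T) : Function.Injective (blockSubgraph T) := by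
  intro b b' h
  have : (innerVertex b : Vertex T) ∈ (blockSubgraph T b').verts := by
    rw [← h]
    exact hT.innerVertex_mem_blockSet.2 rfl
  exact hT.innerVertex_mem_blockSet.1 this

lemma isCutVertex_inl (hT : IsBlockCutTree T) (hG : (glued T).Connected) (c : C) :
    IsCutVertex (glued T) (Sum.inl c) := by
  obtain ⟨b, b', hb, h, h'⟩ := hT.exists_two c
  have hne : ∀ b, (innerVertex b : Vertex T) ∈ ({Sum.inl c}ᶜ : Set (Vertex T)) :=
    fun b h => Sum.inr_ne_inl h
  refine ⟨⟨innerVertex b, hne b⟩, ⟨innerVertex b', hne b'⟩, hG.preconnected _ _, ?_⟩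
  rintro ⟨p⟩
  obtain ⟨d, -, h1, h2⟩ := p.exists_boundary_dart
    {v | proj v.1 ∈ side T (Sum.inl b) (Sum.inr c)} (self_mem_side h)
    (hT.notMem_side_of_mem_blockSet hb h h' (hT.innerVertex_mem_blockSet.2 rfl))
  exact d.snd.2 (hT.eq_of_adj_of_mem_side h d.adj h1 h2).1

/-- Take the block `b` of an edge of `B`. For a vertex `v` of `B` outside `b`, the path in `T` from
`b` towards `v` begins `b`, `c`, `b₂`, so deleting `c` would separate `v` from what `B` retains in
`b`. -/
lemma exists_subset_blockSet (hT : IsBlockCutTree T) {B : (glued T).Subgraph}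
    (hB : IsTwoConnected B) : ∃ b, B.verts ⊆ blockSet T b := by
  obtain ⟨h3, hconn, hdel⟩ := hB
  obtain ⟨s, t, hs, ht, hst⟩ := Set.one_lt_encard_iff.1 (lt_of_lt_of_le (by norm_num) h3)
  obtain ⟨x, hx, y, hy, ⟨hxy, ⟨b, hxb, hyb⟩, -⟩, -⟩ :=
    exists_adj_boundary hconn.induce_verts hs (Set.mem_singleton s) ht (Ne.symm hst)
  refine ⟨b, fun v hv => ?_⟩
  by_contra hvb
  obtain ⟨u, hu, hvu⟩ := exists_mem_side hT.isTree (x := proj v) (v := Sum.inl b)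
    (fun h => hvb (Or.inl h))
  rcases u with b₁ | c
  · exact hT.not_adj_inl _ _ hu
  obtain ⟨u, hu₂, hvu₂⟩ := exists_mem_side hT.isTree (x := proj v) (v := Sum.inr c) (by
    intro h
    rw [proj_eq_inr h] at hvb
    exact hvb (inl_mem_blockSet.2 hu))
  rcases u with b₂ | c₂
  swap
  · exact hT.not_adj_inr _ _ hu₂
  have hb : b₂ ≠ b := by
    rintro rfl
    exact notMem_side hvu hvu₂
  obtain ⟨x', hx', hxb', hxc⟩ : ∃ x' ∈ B.verts, x' ∈ blockSet T b ∧ x' ≠ Sum.inl c := by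
    by_cases h : x = Sum.inl c
    · exact ⟨y, hy, hyb, fun hy => hxy (h.trans hy.symm)⟩
    · exact ⟨x, hx, hxb, h⟩
  have hS : ((glued T).induce (B.verts \ {Sum.inl c})).Connected := by
    by_cases hc : Sum.inl c ∈ B.verts
    · exact (hdel _ hc).induce_verts
    · rw [Set.sdiff_singleton_eq_self hc]
      exact hconn.induce_verts
  have hvc : v ≠ Sum.inl c := by
    rintro rfl
    exact hvb (inl_mem_blockSet.2 hu)
  obtain ⟨p, -, q, hq, hpq, hp, hqA⟩ := exists_adj_boundary hS
    (A := {v | proj v ∈ side T (Sum.inl b₂) (Sum.inr c)}) ⟨hv, hvc⟩ hvu₂ ⟨hx', hxc⟩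
    (hT.notMem_side_of_mem_blockSet hb hu₂.symm hu hxb')
  exact hq.2 (hT.eq_of_adj_of_mem_side hu₂.symm hpq hp hqA).1

lemma le_blockSubgraph {B : (glued T).Subgraph} {b : I} (h : B.verts ⊆ blockSet T b) :
    B ≤ blockSubgraph T b :=
  ⟨h, fun _ _ huv => ⟨h (B.edge_vert huv), h (B.edge_vert huv.symm), B.adj_sub huv⟩⟩

variable [Finite C]

/-- One vertex of a pair avoiding `z` is joined to all of `S` except itself and its partner, and a
second pair links it to the partner. -/
lemma connected_induce_of_subset (hT : IsBlockCutTree T) {b : I} {S : Set (Vertex T)}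
    (hS : S ⊆ blockSet T b) (z : Vertex T) (hz : ∀ v ∈ blockSet T b, v ≠ z → v ∈ S) :
    ((glued T).induce S).Connected := by
  obtain ⟨i, hi⟩ := hT.exists_pair_avoiding b z z
  obtain ⟨j, hj⟩ := hT.exists_pair_avoiding b z (Sum.inr ⟨b, Sum.inr (i, true)⟩)
  have hij : i ≠ j := fun h => (hj true).2 (h ▸ rfl)
  have hmem : ∀ k t, (Sum.inr ⟨b, Sum.inr (k, t)⟩ : Vertex T) ≠ z →
      (Sum.inr ⟨b, Sum.inr (k, t)⟩ : Vertex T) ∈ S :=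
    fun k t h => hz _ (hT.inr_mem_blockSet.2 rfl) h
  rw [SimpleGraph.connected_iff_exists_forall_reachable]
  have hadj : ∀ s t, ((glued T).induce S).Adj ⟨_, hmem i s (hi s).1⟩ ⟨_, hmem j t (hj t).1⟩ := by
    intro s t
    refine hT.adj_inr.2 ⟨hT.inr_mem_blockSet.2 rfl, ?_, ?_⟩ <;> simp [mate, hij.symm]
  refine ⟨⟨_, hmem i true (hi true).1⟩, ?_⟩
  rintro ⟨v, hv⟩
  by_cases h1 : v = Sum.inr ⟨b, Sum.inr (i, true)⟩
  · subst h1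
    exact SimpleGraph.Reachable.refl _
  by_cases h2 : v = Sum.inr ⟨b, Sum.inr (i, false)⟩
  · subst h2
    exact (hadj true true).reachable.trans (hadj false true).symm.reachable
  · exact SimpleGraph.Adj.reachable (hT.adj_inr.2 ⟨hS hv, h1, h2⟩)

lemma connected_glued (hT : IsBlockCutTree T) : (glued T).Connected := by
  obtain ⟨c⟩ := hT.nonempty_cut
  have := hT.connected_induce_of_forall_block (S := Set.univ) ⟨Sum.inl c, trivial⟩
    (fun _ => trivial) (fun b =>
      hT.connected_induce_of_subset Set.inter_subset_right (innerVertex b)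
        (fun v hv _ => ⟨trivial, hv⟩))
  exact (SimpleGraph.induceUnivIso (glued T)).connected_iff.1 this

lemma isCutVertex_iff (hT : IsBlockCutTree T) {v : Vertex T} :
    IsCutVertex (glued T) v ↔ ∃ c, v = Sum.inl c := by
  constructor
  · rintro ⟨a, a', -, h⟩
    cases v with
    | inl c => exact ⟨c, rfl⟩
    | inr p =>
      refine absurd ?_ h
      refine (hT.connected_induce_of_forall_block ⟨a, a.2⟩ (fun c => Sum.inl_ne_inr)
        (fun b => ?_)).preconnected a a'
      exact hT.connected_induce_of_subset Set.inter_subset_right (Sum.inr p)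
        (fun v hv hne => ⟨hne, hv⟩)
  · rintro ⟨c, rfl⟩
    exact hT.isCutVertex_inl hT.connected_glued c

/-- A pair avoiding both ends supplies a common neighbour, hence a triangle. -/
lemma not_isBridge (hT : IsBlockCutTree T) {u v : Vertex T} (h : (glued T).Adj u v) :
    ¬ (glued T).IsBridge s(u, v) := by
  obtain ⟨huv, ⟨b, hub, hvb⟩, -⟩ := h
  obtain ⟨i, hi⟩ := hT.exists_pair_avoiding b u v
  have hu : (glued T).Adj (Sum.inr ⟨b, Sum.inr (i, true)⟩) u :=
    hT.adj_inr.2 ⟨hub, (hi true).1.symm, (hi false).1.symm⟩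
  have hv : (glued T).Adj (Sum.inr ⟨b, Sum.inr (i, true)⟩) v :=
    hT.adj_inr.2 ⟨hvb, (hi true).2.symm, (hi false).2.symm⟩
  rw [SimpleGraph.isBridge_iff, not_not]
  refine (SimpleGraph.Adj.reachable (v := Sum.inr ⟨b, Sum.inr (i, true)⟩) ?_).trans
    (SimpleGraph.Adj.reachable ?_)
  · rw [SimpleGraph.deleteEdges_adj]
    exact ⟨hu.symm, fun h => (hi true).2 (Sym2.congr_right.1 h)⟩
  · rw [SimpleGraph.deleteEdges_adj]
    exact ⟨hv, fun h => (hi true).1 (Sym2.congr_left.1 h)⟩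

variable [Finite I]

lemma isTwoConnected_blockSubgraph (hT : IsBlockCutTree T) (b : I) :
    IsTwoConnected (blockSubgraph T b) := by
  have hcard := hT.ncard_blockSet b
  have h2 := hT.two_le_card
  refine ⟨?_, ?_, fun x hx => ?_⟩
  · change 3 ≤ (blockSet T b).encard
    rw [← (Set.toFinite (blockSet T b)).cast_ncard_eq]
    exact_mod_cast (by omega : 3 ≤ (blockSet T b).ncard)
  · exact SimpleGraph.connected_induce_iff.1
      (hT.connected_induce_of_subset subset_rfl (innerVertex b) (fun v hv _ => hv))
  · have h := SimpleGraph.connected_induce_iff.1 (hT.connected_induce_of_subset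
      (S := blockSet T b \ {x}) Set.sdiff_subset x (fun v hv hne => ⟨hv, hne⟩))
    refine SimpleGraph.Subgraph.Connected.mono
      (H := (⊤ : (glued T).Subgraph).induce (blockSet T b \ {x}))
      (H' := (blockSubgraph T b).deleteVerts {x})
      ⟨subset_rfl, fun u v huv => ?_⟩ rfl h
    exact SimpleGraph.Subgraph.deleteVerts_adj.2
      ⟨huv.1.1, huv.1.2, huv.2.1.1, huv.2.1.2, ⟨huv.1.1, huv.2.1.1, huv.2.2⟩⟩

lemma isBlock_iff (hT : IsBlockCutTree T) {B : (glued T).Subgraph} :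
    IsBlock (glued T) B ↔ ∃ b, B = blockSubgraph T b := by
  constructor
  · rintro (⟨x, y, h, hb, -⟩ | hB)
    · exact absurd hb (hT.not_isBridge h)
    · obtain ⟨b, hb⟩ := hT.exists_subset_blockSet hB.prop
      exact ⟨b, hB.eq_of_le (hT.isTwoConnected_blockSubgraph b) (le_blockSubgraph hb)⟩
  · rintro ⟨b, rfl⟩
    refine Or.inr ⟨hT.isTwoConnected_blockSubgraph b, fun B hB hle => ?_⟩
    obtain ⟨b', hb'⟩ := hT.exists_subset_blockSet hB
    obtain rfl : b = b' := hT.innerVertex_mem_blockSet.1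
      (hb' (hle.1 (hT.innerVertex_mem_blockSet.2 rfl)))
    exact le_blockSubgraph hb'

lemma nonempty_iso_blockTree (hT : IsBlockCutTree T) : Nonempty (T ≃g blockTree (glued T)) := by
  let e₁ : I → {B : (glued T).Subgraph // IsBlock (glued T) B} :=
    fun b => ⟨blockSubgraph T b, hT.isBlock_iff.2 ⟨b, rfl⟩⟩
  have h₁ : Function.Bijective e₁ :=
    ⟨fun b b' h => hT.blockSubgraph_injective (congrArg Subtype.val h), by
      rintro ⟨B, hB⟩
      obtain ⟨b, rfl⟩ := hT.isBlock_iff.1 hB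
      exact ⟨b, rfl⟩⟩
  let e₂ : C → {v : Vertex T // IsCutVertex (glued T) v} :=
    fun c => ⟨Sum.inl c, hT.isCutVertex_iff.2 ⟨c, rfl⟩⟩
  have h₂ : Function.Bijective e₂ :=
    ⟨fun c c' h => Sum.inl_injective (congrArg Subtype.val h), by
      rintro ⟨v, hv⟩
      obtain ⟨c, rfl⟩ := hT.isCutVertex_iff.1 hv
      exact ⟨c, rfl⟩⟩
  refine ⟨⟨Equiv.sumCongr (Equiv.ofBijective e₁ h₁) (Equiv.ofBijective e₂ h₂), ?_⟩⟩
  rintro (b | c) (b' | c')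
  · exact iff_of_false id (hT.not_adj_inl _ _)
  · exact inl_mem_blockSet
  · exact inl_mem_blockSet.trans (T.adj_comm _ _)
  · exact iff_of_false id (hT.not_adj_inr _ _)

end IsBlockCutTree

lemma vertexConnectivity_eq_one {V : Type*} {G : SimpleGraph V} (hG : G.Connected) {c : V}
    (hc : IsCutVertex G c) : vertexConnectivity G = 1 := by
  have hmem : 1 ∈ {k | ∃ S : Finset V, S.card = k ∧
      (¬ (G.induce ((S : Set V)ᶜ)).Preconnected ∨ ((S : Set V)ᶜ).Subsingleton)} := by
    obtain ⟨a, b, -, hab⟩ := hc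
    refine ⟨{c}, Finset.card_singleton c, Or.inl fun h => hab ?_⟩
    rw [Finset.coe_singleton] at h
    exact h a b
  refine le_antisymm (Nat.sInf_le hmem) (Nat.one_le_iff_ne_zero.2 fun h0 => ?_)
  rcases Nat.sInf_eq_zero.1 h0 with ⟨S, hS, h⟩ | h
  · rw [Finset.card_eq_zero] at hS
    subst hS
    rw [Finset.coe_empty, Set.compl_empty] at h
    rcases h with h | h
    · exact h ((SimpleGraph.induceUnivIso G).connected_iff.2 hG).preconnected
    · obtain ⟨a, b, -, hab⟩ := hc
      exact hab (by rw [Subtype.ext (h (Set.mem_univ a.1) (Set.mem_univ b.1))])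
  · rw [h] at hmem
    exact hmem

end BlockTree

end BlockStructure

namespace BlockStructure

/-! ### The two cases of the theorem -/

lemma not_adj_blockTree_inl {V : Type*} {G : SimpleGraph V}
    (B B' : {B : G.Subgraph // IsBlock G B}) :
    ¬ (blockTree G).Adj (Sum.inl B) (Sum.inl B') := id

lemma not_adj_blockTree_inr {V : Type*} {G : SimpleGraph V} (c c' : {c : V // IsCutVertex G c}) :
    ¬ (blockTree G).Adj (Sum.inr c) (Sum.inr c') := id

lemma isBlockCutTree_blockTree {V : Type} [Finite V] {G : SimpleGraph V} (hG : G.Connected)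
    (hT : (blockTree G).IsTree) (hne : (blockTree G).edgeSet.Nonempty) :
    IsBlockCutTree (blockTree G) where
  isTree := hT
  not_adj_inl := not_adj_blockTree_inl
  not_adj_inr := not_adj_blockTree_inr
  exists_two := by
    rintro ⟨c, hc⟩
    obtain ⟨B₁, B₂, h₁, h₂, h, hc₁, hc₂⟩ := exists_two_blocks hG hc
    exact ⟨⟨B₁, h₁⟩, ⟨B₂, h₂⟩, fun h' => h (congrArg Subtype.val h'), hc₁, hc₂⟩
  nonempty_cut := by
    obtain ⟨⟨x, y⟩, h⟩ := hne
    rcases x with B | c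
    · rcases y with B' | c
      · exact (not_adj_blockTree_inl B B' h).elim
      · exact ⟨c⟩
    · exact ⟨c⟩

/-- The case of a tree with a single vertex: the one edge is a cut-edge, and there is no cut-vertex.
-/
lemma isBlockTreeOf_top_bool {V : Type*} {T : SimpleGraph V} [Subsingleton V] [Nonempty V] :
    IsBlockTreeOf T (⊤ : SimpleGraph Bool) := by
  refine ⟨SimpleGraph.connected_top, ?_⟩
  have hcut : ∀ c, ¬ IsCutVertex (⊤ : SimpleGraph Bool) c := by
    rintro c ⟨⟨a, ha⟩, ⟨b, hb⟩, -, h⟩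
    obtain rfl : a = b := by
      rw [Bool.eq_not_of_ne ha, Bool.eq_not_of_ne hb]
    exact h (SimpleGraph.Reachable.refl _)
  have hadj : (⊤ : SimpleGraph Bool).Adj false true := by simp
  have hbridge : (⊤ : SimpleGraph Bool).IsBridge s(false, true) := by
    rw [SimpleGraph.isBridge_iff_forall_walk_mem_edges]
    intro p
    obtain ⟨d, hd, h1, h2⟩ := p.exists_boundary_dart {false} rfl (by simp)
    have h3 : d.snd = true := by simpa using h2
    rw [SimpleGraph.Walk.edges, List.mem_map]
    refine ⟨d, hd, ?_⟩
    rw [SimpleGraph.Dart.edge, ← Set.mem_singleton_iff.1 h1, ← h3]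
  have hblock : ∀ B, IsBlock (⊤ : SimpleGraph Bool) B → B = SimpleGraph.subgraphOfAdj _ hadj := by
    rintro B (⟨x, y, h, -, rfl⟩ | h)
    · cases x <;> cases y
      · simp at h
      · rfl
      · exact SimpleGraph.subgraphOfAdj_symm hadj
      · simp at h
    · have h3 := h.prop.1.trans (Set.encard_le_encard (Set.subset_univ _))
      rw [Set.encard_univ, ENat.card_eq_coe_fintype_card, Fintype.card_bool] at h3
      exact absurd h3 (by norm_num)
  let x₀ : {B // IsBlock (⊤ : SimpleGraph Bool) B} ⊕ {c // IsCutVertex (⊤ : SimpleGraph Bool) c} :=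
    Sum.inl ⟨_, Or.inl ⟨false, true, hadj, hbridge, rfl⟩⟩
  have hx₀ : ∀ x, x = x₀ := by
    rintro (⟨B, hB⟩ | ⟨c, hc⟩)
    · exact congrArg Sum.inl (Subtype.ext (hblock B hB))
    · exact absurd hc (hcut c)
  obtain ⟨v₀⟩ := ‹Nonempty V›
  refine ⟨⟨⟨fun _ => x₀, fun _ => v₀, fun _ => Subsingleton.elim _ _, fun x => (hx₀ x).symm⟩, ?_⟩⟩
  intro a b
  refine iff_of_false (SimpleGraph.irrefl _) ?_
  rw [Subsingleton.elim a b]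
  exact SimpleGraph.irrefl _

lemma memDHat_top_bool :
    (⊤ : SimpleGraph Bool).minDegree = 0 + 1 ∧ MemDHat 0 (⊤ : SimpleGraph Bool) := by
  refine memDHat_of_card_le (fun v => by simp) fun W _ H _ ⟨w⟩ _ hH => ?_
  obtain ⟨w', hw'⟩ := (H.degree_pos_iff_exists_adj w).1 (hH w)
  rw [Fintype.card_bool]
  exact Fintype.one_lt_card_iff.2 ⟨w, w', H.ne_of_adj hw'⟩

lemma ncard_edgeSet_add_one {V : Type*} [Finite V] {T : SimpleGraph V} (hT : T.IsTree) :
    T.edgeSet.ncard + 1 = Nat.card V := by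
  classical
  have := Fintype.ofFinite V
  rw [Nat.card_eq_fintype_card, ← hT.card_edgeFinset, Set.ncard_eq_toFinset_card']
  rfl

end BlockStructure

theorem mainTheorem4 {V : Type*} (T : SimpleGraph V)
    (hT : BlockStructure.IsBlockDecompositionTree T) :
    ∃ (W : Type) (_ : Fintype W) (G : SimpleGraph W) (_ : DecidableRel G.Adj),
      BlockStructure.IsBlockTreeOf T G ∧
      (∃ k : ℕ, G.minDegree = k + 1 ∧ BlockStructure.MemDHat k G) ∧
      (T.edgeSet.Nonempty →
        G.minDegree ≤ 8 * T.edgeSet.ncard ∧ BlockStructure.vertexConnectivity G = 1) := by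
  obtain ⟨hTree, W, hW, H, hH, ⟨e⟩⟩ := hT
  by_cases hne : T.edgeSet.Nonempty
  · have hBT : BlockStructure.IsBlockCutTree (BlockStructure.blockTree H) := by
      refine BlockStructure.isBlockCutTree_blockTree hH (e.isTree_iff.1 hTree) ?_
      obtain ⟨⟨x, y⟩, h⟩ := hne
      exact ⟨s(e x, e y), e.map_adj_iff.2 h⟩
    have : Finite V := Finite.of_equiv _ e.symm.toEquiv
    classical
    obtain ⟨e'⟩ := hBT.nonempty_iso_blockTree
    have : Fintype (BlockStructure.Vertex (BlockStructure.blockTree H)) := Fintype.ofFinite _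
    obtain ⟨hmin, hD⟩ := hBT.memDHat_glued
    have h2 := hBT.two_le_card
    have hcard := BlockStructure.ncard_edgeSet_add_one hTree
    rw [Nat.card_congr e.toEquiv] at hcard
    -- As n = |E(T)| + 1, the degree is 6|E(T)|, within the bound 8|E(T)|.
    refine ⟨_, inferInstance, BlockStructure.glued (BlockStructure.blockTree H), inferInstance,
      ⟨hBT.connected_glued, ⟨e.trans e'⟩⟩, ⟨_, by omega, hD⟩, fun _ => ⟨by omega, ?_⟩⟩
    obtain ⟨c⟩ := hBT.nonempty_cut
    exact BlockStructure.vertexConnectivity_eq_one hBT.connected_glued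
      (hBT.isCutVertex_inl hBT.connected_glued c)
  · have : Nonempty V := hTree.connected.nonempty
    have : Subsingleton V := by
      refine ⟨fun x y => ?_⟩
      by_contra hxy
      obtain ⟨u, hu, -⟩ := BlockStructure.exists_mem_side hTree hxy
      exact hne ⟨s(y, u), hu⟩
    exact ⟨Bool, inferInstance, ⊤, inferInstance, BlockStructure.isBlockTreeOf_top_bool,
      ⟨0, BlockStructure.memDHat_top_bool⟩, fun h => absurd h hne⟩
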